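/- Let $d\ge 1$, let $\mathbb{R}_+^{d+1}=\{x\in\mathbb{R}^{d+1}: x_i\ge 0\ \text{for all } i\}$, $\Delta^d=S^d\cap\mathbb{R}_+^{d+1}$ and $\partial\Delta^d=\{\mathbf n\in\Delta^d : n_i=0 \text{ for some } i\}$. Let $\eta:\Delta^d\to[0,\infty)$ be continuous, not identically zero, and such that $\eta(\mathbf n)\to 0$ uniformly as $\mathbf n\to\partial\Delta^d$. For $q>0$ let $\bar D_q$ be the set of all monotone surfaces enclosing volume $q$ in the octant, that is, of all $G\subset\mathbb{R}_+^{d+1}$ such that - $G$ is an embedded topological hypersurface (a $d$-dimensional manifold in the induced topology) whose complement in $\mathbb{R}^{d+1}$ consists of two connected parts, the lower one, which contains the complement of the octant (and therefore all points of $\partial\mathbb{R}_+^{d+1}$ that are not on $G$), and the upper one, and $G$ is the boundary of each of them; - for almost every $x\in G$ with respect to $d$-dimensional surface area $ds$ (Hausdorff measure), $G$ has a unit normal vector $\mathbf n_x$ at $x$, oriented from the lower to the upper part, and $\mathbf n_x\in\Delta^d$; - the body $Q(G)$ enclosed between $\partial\mathbb{R}_+^{d+1}$ and $G$ (the intersection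 of the octant with the lower part) has volume $\mathrm{vol}(G)=q$. Put $$\mathcal V_\eta(G)=\int_G\eta(\mathbf n_x)\,ds_x,\qquad K_\eta^{>}=\{x\in\mathbb{R}^{d+1}:(x,\mathbf n)\ge\eta(\mathbf n)\ \text{for all }\mathbf n\in\Delta^d\},\qquad G_\eta=\partial K_\eta^{>}.$$ If $\mathrm{vol}(G_\eta)<\infty$, then the functional $\mathcal V_\eta$ has a unique maximizer over $\bar D_1$, namely the rescaled surface $$V_\eta=\left(\frac{d+1}{\mathcal V_\eta(G_\eta)}\right)^{1/(d+1)}G_\eta .$$ If $\mathrm{vol}(G_\eta)=\infty$, then $\sup_{G\in\bar D_1}\mathcal V_\eta(G)=\infty$. -/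

import Mathlib

open MeasureTheory Set Topology
open scoped Pointwise ENNReal

namespace DualWulff

noncomputable section

/-- The Euclidean space `ℝ^{d+1}`. -/
abbrev Space (d : ℕ) : Type := EuclideanSpace ℝ (Fin (d + 1))

/-- The closed positive octant of `ℝ^{d+1}`. -/
def octant (d : ℕ) : Set (Space d) := {x | ∀ i, 0 ≤ x i}

/-- The spherical octant `Δ^d`: the unit vectors lying in the closed positive octant. -/
def sphericalOctant (d : ℕ) : Set (Space d) := Metric.sphere 0 1 ∩ octant d

/-- The (relative) boundary `∂Δ^d` of the spherical octant. -/
def sphericalOctantBoundary (d : ℕ) : Set (Space d) :=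
  {n | n ∈ sphericalOctant d ∧ ∃ i, n i = 0}

/-- `η(n) → 0` uniformly as `n → ∂Δ^d`. -/
def VanishesAtBoundary {d : ℕ} (η : Space d → ℝ) : Prop :=
  ∀ ε > 0, ∃ δ > 0, ∀ n ∈ sphericalOctant d, ∀ m ∈ sphericalOctantBoundary d,
    dist n m < δ → |η n| < ε

/-- The point `(-1, …, -1)`, which lies outside the octant. -/
def outerPoint (d : ℕ) : Space d := WithLp.toLp 2 (fun _ => (-1 : ℝ))

/-- The part of the complement of `G` below `G`: the connected component of `ℝ^{d+1} \ G` that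
contains the point `(-1, …, -1)`. If `G` is a closed subset of the octant, this component contains
the whole complement of the octant, and hence also all the points of the boundary of the octant
that are not on `G`. (Components are taken in `ℝ^{d+1}` and not in the octant because `G` is allowed
to have common points, and even common flat pieces, with the boundary of the octant.) -/
def lowerPart {d : ℕ} (G : Set (Space d)) : Set (Space d) :=
  connectedComponentIn Gᶜ (outerPoint d)

/-- The part of space beyond `G`: everything that is neither on `G` nor below `G`. -/
def upperPart {d : ℕ} (G : Set (Space d)) : Set (Space d) := (G ∪ lowerPart G)ᶜ

/-- The body `Q(G)` enclosed between the boundary of the octant and `G`. -/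
def body {d : ℕ} (G : Set (Space d)) : Set (Space d) := octant d ∩ lowerPart G

/-- `vol(G)`, the `(d+1)`-dimensional volume of the body `Q(G)`. -/
def vol {d : ℕ} (G : Set (Space d)) : ℝ≥0∞ := volume (body G)

/-- `n` is the unit normal vector of `G` at `x`, oriented from the body below `G` to the part
beyond `G`: up to a cone of arbitrarily small opening around the hyperplane through `x` orthogonal
to `n`, near `x` one side of this hyperplane is below `G` and the other side is beyond `G`. -/
def IsNormalAt {d : ℕ} (G : Set (Space d)) (x n : Space d) : Prop :=
  ‖n‖ = 1 ∧ ∀ ε > 0, ∀ᶠ y in 𝓝 x,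
    (ε * ‖y - x‖ < inner ℝ (y - x) n → y ∈ upperPart G) ∧
    (inner ℝ (y - x) n < -(ε * ‖y - x‖) → y ∈ lowerPart G)

open Classical in
/-- The normal vector `n_x` of `G` at `x` (it is unique if it exists; `0` if there is none). -/
def normal {d : ℕ} (G : Set (Space d)) (x : Space d) : Space d :=
  if h : ∃ n, IsNormalAt G x n then h.choose else 0

/-- The functional `𝒱_η(G) = ∫_G η(n_x) ds_x`, where `ds` is the `d`-dimensional surface area
(the `d`-dimensional Hausdorff measure, normalized so as to agree with Lebesgue measure on
`ℝ^d`). -/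
def functional {d : ℕ} (η : Space d → ℝ) (G : Set (Space d)) : ℝ≥0∞ :=
  ∫⁻ x in G, ENNReal.ofReal (η (normal G x)) ∂μHE[d]

/-- The class `D̄_q` of monotone surfaces in the octant enclosing the volume `q`. -/
structure IsMonotoneSurface {d : ℕ} (q : ℝ≥0∞) (G : Set (Space d)) : Prop where
  /-- `G` lies in the octant. -/
  subset_octant : G ⊆ octant d
  /-- `G` is a hypersurface: with the topology of `ℝ^{d+1}` it is a `d`-dimensional manifold. -/
  manifold : Nonempty (ChartedSpace (EuclideanSpace ℝ (Fin d)) G)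
  /-- `G` splits the space (hence the octant) in two parts: the connected part below `G`, to which
  the boundary of the octant belongs, and the connected part beyond `G`. -/
  isConnected_upperPart : IsConnected (upperPart G)
  /-- `G` is the boundary of the first part, … -/
  frontier_lowerPart : frontier (lowerPart G) = G
  /-- … and the boundary of the second one. -/
  frontier_upperPart : frontier (upperPart G) = G
  /-- At almost every point of `G` the normal vector is defined and lies in `Δ^d`. -/
  ae_normal : ∀ᵐ x ∂((μHE[d] : Measure (Space d)).restrict G),
    ∃ n ∈ sphericalOctant d, IsNormalAt G x n
  /-- The body enclosed between the boundary of the octant and `G` has volume `q`. -/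
  vol_eq : vol G = q

/-- The class `D̄_q` as a set of surfaces. -/
def monotoneSurfaces (d : ℕ) (q : ℝ≥0∞) : Set (Set (Space d)) := {G | IsMonotoneSurface q G}

/-- `K_η^> = {x : (x, n) ≥ η(n) for all n ∈ Δ^d}`. -/
def dualWulffBody {d : ℕ} (η : Space d → ℝ) : Set (Space d) :=
  {x | ∀ n ∈ sphericalOctant d, η n ≤ inner ℝ x n}

/-- The dual Wulff surface `G_η = ∂ K_η^>`. -/
def dualWulffSurface {d : ℕ} (η : Space d → ℝ) : Set (Space d) := frontier (dualWulffBody η)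

end

end DualWulff

/-!
The proof reduces everything to closed sets that are stable under the addition of vectors of the
octant (`IsUpperBody`), and then compares surfaces through their radial functions.

*Monotone surfaces.* The surfaces of the class are exactly the boundaries of upper bodies, with the
volume of the region below the body. If `G` is a monotone surface, then, since a set without surface
area projects to a null set on every hyperplane, a generic line in a positive direction meets `G`
only at points with a normal vector in the spherical octant. There it passes from below to above,
so it never comes back (`IsMonotoneSurface.isUpperBody_compl_lowerPart`). Conversely, the boundary
of an upper body is the graph of a Lipschitz function over the hyperplane orthogonal to the
diagonal, and Rademacher's theorem provides the normal vectors
(`IsUpperBody.isMonotoneSurface_frontier`).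

*Upper bound.* Let `K` be the dual Wulff body, and let `ρ` and `r` be the radial functions of `K` and
of an upper body `C`. At a point `x = r θ` of the boundary of `C` with normal vector `n`, the point
`ρ θ` belongs to `K`, so that `η n ≤ (ρ / r) (x, n)`. By the area formula for Lipschitz graphs
(`Frame.area_image_graphMap`) and the change of variables `(u, t) ↦ t x(u)`
(`IsUpperBody.lintegral_cone`), `(x, n) ds` is `d + 1` times the volume of the cone over `ds`, that
is, `r ^ (d + 1) dθ`. Hence the functional is at most `∫ ρ r ^ d dθ` (`IsUpperBody.functional_le`).
Equality holds if `C` is a dilate of `K`, because some constraint `(x, m) ≥ η m` is active at each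
boundary point of `K`, and then `m` is the normal vector wherever there is one
(`functional_smul_dualWulffBody`).

*Maximizer.* Let `C₀ = c K` be the dilate of `K` with unit volume below it. As both volumes are `1`,
the integrals of `r ^ (d + 1)` and of `(c ρ) ^ (d + 1)` are `d + 1`. So the arithmetic-geometric mean
inequality `(d + 1) (c ρ) r ^ d ≤ (c ρ) ^ (d + 1) + d r ^ (d + 1)` shows that `∫ ρ r ^ d dθ` is
largest for `r = c ρ`, and only then (`IsUpperBody.mixed_volume`).

*Infinite volume.* The truncations `max (η - ε, 0)` have dual Wulff bodies with finite volume below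
them, and these volumes increase to that of `η` as `ε` decreases to `0`; the optimal surfaces of the
truncations make the functional arbitrarily large (`iSup_functional_eq_top`).
-/

namespace DualWulff

noncomputable section

/-! ### Orthogonal frames and graphs over a hyperplane -/

/-- The parameter space `ℝ^d` of the hyperplanes of `ℝ^{d+1}`. -/
abbrev Base (d : ℕ) : Type := EuclideanSpace ℝ (Fin d)

/-- A unit vector of `ℝ^{d+1}`, together with an isometric parametrization of its orthogonal
hyperplane by `ℝ^d`. -/
structure Frame (d : ℕ) where
  /-- The unit vector. -/
  axis : Space d
  /-- The parametrization of the hyperplane orthogonal to the unit vector. -/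
  base : Base d →ₗᵢ[ℝ] Space d
  norm_axis : ‖axis‖ = 1
  inner_base_axis : ∀ u, inner ℝ (base u) axis = 0

namespace Frame

variable {d : ℕ}

theorem exists_axis_eq (e : Space d) (he : ‖e‖ = 1) : ∃ Φ : Frame d, Φ.axis = e := by
  have hne : e ≠ 0 := by rintro rfl; simp at he
  have : Fact (Module.finrank ℝ (Space d) = d + 1) := ⟨by simp⟩
  let b := OrthonormalBasis.fromOrthogonalSpanSingleton (𝕜 := ℝ) d hne
  refine ⟨⟨e, (Submodule.subtypeₗᵢ _).comp b.repr.symm.toLinearIsometry, he, fun u => ?_⟩, rfl⟩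
  have := (b.repr.symm u).2
  rw [Submodule.mem_orthogonal_singleton_iff_inner_left] at this
  exact this

variable (Φ : Frame d)

@[simp] theorem inner_axis_axis : inner ℝ Φ.axis Φ.axis = (1 : ℝ) := by
  rw [real_inner_self_eq_norm_sq, Φ.norm_axis]; norm_num

@[simp] theorem inner_base_axis' (u : Base d) : inner ℝ (Φ.base u) Φ.axis = (0 : ℝ) :=
  Φ.inner_base_axis u

@[simp] theorem inner_axis_base (u : Base d) : inner ℝ Φ.axis (Φ.base u) = (0 : ℝ) := by
  rw [real_inner_comm]; exact Φ.inner_base_axis u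

/-- The point with given coordinates along the hyperplane and along the axis of the frame. -/
def pt (p : Base d × ℝ) : Space d := Φ.base p.1 + p.2 • Φ.axis

theorem norm_pt_sq (p : Base d × ℝ) : ‖Φ.pt p‖ ^ 2 = ‖p.1‖ ^ 2 + p.2 ^ 2 := by
  rw [pt, norm_add_sq_real, inner_smul_right, Φ.inner_base_axis, norm_smul, Φ.norm_axis,
    Φ.base.norm_map]
  simp

/-- The isometric coordinates given by a frame. -/
def isom : WithLp 2 (Base d × ℝ) ≃ₗᵢ[ℝ] Space d :=
  LinearIsometry.toLinearIsometryEquiv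
    { toFun := fun p => Φ.pt (WithLp.ofLp p)
      map_add' := fun p q => by
        change Φ.base (p.fst + q.fst) + (p.snd + q.snd) • Φ.axis
          = (Φ.base p.fst + p.snd • Φ.axis) + (Φ.base q.fst + q.snd • Φ.axis)
        rw [map_add, add_smul]
        abel
      map_smul' := fun c p => by
        change Φ.base (c • p.fst) + (c * p.snd) • Φ.axis
          = c • (Φ.base p.fst + p.snd • Φ.axis)
        rw [map_smul, smul_add, mul_smul]
      norm_map' := fun p => by
        have h : ‖p‖ ^ 2 = ‖Φ.pt (WithLp.ofLp p)‖ ^ 2 := by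
          rw [norm_pt_sq, WithLp.prod_norm_sq_eq_of_L2]; simp
        exact (sq_eq_sq₀ (norm_nonneg _) (norm_nonneg _)).1 h.symm }
    (by
      rw [LinearEquiv.finrank_eq (WithLp.linearEquiv 2 ℝ (Base d × ℝ))]
      simp)

/-- The coordinates of a frame, as a linear homeomorphism. -/
def ptL : (Base d × ℝ) ≃L[ℝ] Space d :=
  (WithLp.prodContinuousLinearEquiv 2 ℝ (Base d) ℝ).symm.trans Φ.isom.toContinuousLinearEquiv

theorem ptL_apply (p : Base d × ℝ) : Φ.ptL p = Φ.pt p := rfl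

theorem measurePreserving_ptL : MeasurePreserving Φ.ptL volume volume :=
  Φ.isom.measurePreserving.comp (WithLp.volume_preserving_toLp (Base d) ℝ)

/-- The component along the hyperplane. -/
def proj (x : Space d) : Base d := (Φ.ptL.symm x).1

@[simp] theorem proj_pt (p : Base d × ℝ) : Φ.proj (Φ.pt p) = p.1 := by
  rw [proj, ← ptL_apply, ContinuousLinearEquiv.symm_apply_apply]

@[simp] theorem inner_pt_axis (p : Base d × ℝ) : inner ℝ (Φ.pt p) Φ.axis = p.2 := by
  rw [pt, inner_add_left, inner_smul_left, Φ.inner_axis_axis]; simp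

theorem pt_proj (x : Space d) : Φ.pt (Φ.proj x, inner ℝ x Φ.axis) = x := by
  obtain ⟨p, rfl⟩ := Φ.ptL.surjective x
  simp [ptL_apply]

theorem pt_sub (p q : Base d × ℝ) : Φ.pt p - Φ.pt q = Φ.pt (p - q) := by
  rw [← ptL_apply, ← ptL_apply, ← ptL_apply, map_sub]

theorem smul_pt (c : ℝ) (p : Base d × ℝ) : c • Φ.pt p = Φ.pt (c • p) := by
  rw [← ptL_apply, ← ptL_apply, map_smul]

theorem norm_fst_le (p : Base d × ℝ) : ‖p.1‖ ≤ ‖Φ.pt p‖ := by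
  have := Φ.norm_pt_sq p
  exact abs_le_of_sq_le_sq' (by nlinarith [sq_nonneg p.2]) (norm_nonneg _) |>.2

theorem abs_snd_le (p : Base d × ℝ) : |p.2| ≤ ‖Φ.pt p‖ := by
  have := Φ.norm_pt_sq p
  exact abs_le_of_sq_le_sq (by nlinarith [sq_nonneg ‖p.1‖]) (norm_nonneg _)

theorem continuous_proj : Continuous Φ.proj := continuous_fst.comp Φ.ptL.symm.continuous

theorem lipschitz_proj : LipschitzWith 1 Φ.proj := by
  refine LipschitzWith.of_dist_le_mul fun x y => ?_
  obtain ⟨p, rfl⟩ := Φ.ptL.surjective x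
  obtain ⟨q, rfl⟩ := Φ.ptL.surjective y
  simp only [ptL_apply, proj_pt, dist_eq_norm, pt_sub, NNReal.coe_one, one_mul]
  exact Φ.norm_fst_le (p - q)

/-- The parametrization of the graph of `f` over the hyperplane of the frame. -/
def graphMap (f : Base d → ℝ) (u : Base d) : Space d := Φ.pt (u, f u)

@[simp] theorem proj_graphMap (f : Base d → ℝ) (u : Base d) : Φ.proj (Φ.graphMap f u) = u := by
  simp [graphMap]

theorem continuous_graphMap {f : Base d → ℝ} (hf : Continuous f) : Continuous (Φ.graphMap f) :=
  Φ.ptL.continuous.comp (continuous_id.prodMk hf)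

theorem isClosedEmbedding_graphMap {f : Base d → ℝ} (hf : Continuous f) :
    IsClosedEmbedding (Φ.graphMap f) :=
  Function.LeftInverse.isClosedEmbedding (Φ.proj_graphMap f) Φ.continuous_proj
    (Φ.continuous_graphMap hf)

/-! ### The area formula for Lipschitz graphs -/

/-- The derivative of the graph map of a function with derivative `ℓ`. -/
def graphDeriv (ℓ : Base d →L[ℝ] ℝ) : Base d →L[ℝ] Space d :=
  Φ.base.toContinuousLinearMap + ℓ.smulRight Φ.axis

theorem graphDeriv_apply (ℓ : Base d →L[ℝ] ℝ) (u : Base d) :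
    Φ.graphDeriv ℓ u = Φ.pt (u, ℓ u) := rfl

theorem hasFDerivAt_graphMap {f : Base d → ℝ} {u : Base d} {ℓ : Base d →L[ℝ] ℝ}
    (h : HasFDerivAt f ℓ u) : HasFDerivAt (Φ.graphMap f) (Φ.graphDeriv ℓ) u := by
  have h1 : HasFDerivAt (fun v => Φ.base v) Φ.base.toContinuousLinearMap u :=
    Φ.base.toContinuousLinearMap.hasFDerivAt
  exact h1.add (h.smul_const Φ.axis)

theorem norm_le_norm_graphDeriv (ℓ : Base d →L[ℝ] ℝ) (u : Base d) :
    ‖u‖ ≤ ‖Φ.graphDeriv ℓ u‖ := Φ.norm_fst_le (u, ℓ u)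

/-- The density of the surface area of a graph with derivative `ℓ`. -/
def areaFactor (ℓ : Base d →L[ℝ] ℝ) : ℝ := √(1 + ‖ℓ‖ ^ 2)

theorem one_le_areaFactor (ℓ : Base d →L[ℝ] ℝ) : 1 ≤ areaFactor ℓ := by
  rw [areaFactor, Real.one_le_sqrt]; nlinarith [sq_nonneg ‖ℓ‖]

theorem normDet_graphDeriv (ℓ : Base d →L[ℝ] ℝ) :
    (Φ.graphDeriv ℓ).toLinearMap.normDet = areaFactor ℓ := by
  set a := (InnerProductSpace.toDual ℝ (Base d)).symm ℓ with ha
  have hℓ : ∀ u, ℓ u = inner ℝ a u := fun u => by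
    rw [ha, InnerProductSpace.toDual_symm_apply]
  have hna : ‖a‖ = ‖ℓ‖ := by rw [ha, LinearIsometryEquiv.norm_map]
  have key : (LinearMap.adjoint (Φ.graphDeriv ℓ).toLinearMap) ∘ₗ (Φ.graphDeriv ℓ).toLinearMap
      = LinearMap.transvection ℓ.toLinearMap a := by
    ext1 u
    refine ext_inner_left ℝ fun v => ?_
    rw [LinearMap.comp_apply, LinearMap.adjoint_inner_right]
    simp only [ContinuousLinearMap.coe_coe, graphDeriv_apply, pt, inner_add_left, inner_add_right,
      inner_smul_left, inner_smul_right, Φ.inner_base_axis', Φ.inner_axis_base,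
      Φ.inner_axis_axis, LinearIsometry.inner_map_map, LinearMap.transvection.apply]
    simp only [hℓ, real_inner_comm a v]
    simp
  have h2 := (Φ.graphDeriv ℓ).toLinearMap.normDet_sq
  rw [key, LinearMap.transvection.det] at h2
  have h3 : (Φ.graphDeriv ℓ).toLinearMap.normDet ^ 2 = 1 + ‖ℓ‖ ^ 2 := by
    refine Eq.trans (by simpa using h2) ?_
    simp only [hℓ, real_inner_self_eq_norm_sq, hna]
  rw [areaFactor, ← h3, Real.sqrt_sq (LinearMap.normDet_nonneg _)]

theorem area_image_graphDeriv (ℓ : Base d →L[ℝ] ℝ) (s : Set (Base d)) :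
    (μHE[d] : Measure (Space d)) (Φ.graphDeriv ℓ '' s) =
      ENNReal.ofReal (areaFactor ℓ) * volume s := by
  have := (Φ.graphDeriv ℓ).toLinearMap.euclideanHausdorffMeasure_image_eq_normDet_mul_volume s
  rw [Φ.normDet_graphDeriv] at this
  simpa using this

end Frame

/-- A Lipschitz map increases the surface area at most by the `d`-th power of the constant. -/
theorem area_image_le {X Y : Type*} [MetricSpace X] [MeasurableSpace X] [BorelSpace X]
    [MetricSpace Y] [MeasurableSpace Y] [BorelSpace Y] (d : ℕ) {g : X → Y} {K : NNReal} {s : Set X}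
    (h : LipschitzOnWith K g s) :
    (μHE[d] : Measure Y) (g '' s) ≤ (K : ℝ≥0∞) ^ d * (μHE[d] : Measure X) s := by
  simp_rw [Measure.euclideanHausdorffMeasure_def, Measure.smul_apply, ENNReal.smul_def, smul_eq_mul]
  rw [mul_left_comm]
  gcongr
  have := h.hausdorffMeasure_image_le (d := d) (by positivity)
  simpa using this

theorem measure_le_mul_of_countable_cover {α : Type*} [MeasurableSpace α] {m₁ m₂ : Measure α}
    {s : Set α} {t : ℕ → Set α} (hs : MeasurableSet s) (ht : ∀ n, MeasurableSet (t n))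
    (hd : Pairwise (Function.onFun Disjoint t)) (hst : s ⊆ ⋃ n, t n) (C : ℝ≥0∞)
    (h : ∀ n, m₁ (s ∩ t n) ≤ C * m₂ (s ∩ t n)) : m₁ s ≤ C * m₂ s := by
  have hU : s = ⋃ n, s ∩ t n := by rw [← inter_iUnion, inter_eq_left.2 hst]
  have hd' : Pairwise (Function.onFun Disjoint fun n => s ∩ t n) := fun i j hij =>
    (hd hij).mono inter_subset_right inter_subset_right
  calc m₁ s ≤ ∑' n, m₁ (s ∩ t n) := by
        conv_lhs => rw [hU]
        exact measure_iUnion_le _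
    _ ≤ ∑' n, C * m₂ (s ∩ t n) := ENNReal.tsum_le_tsum h
    _ = C * m₂ s := by
        rw [ENNReal.tsum_mul_left, ← measure_iUnion hd' fun n => hs.inter (ht n), ← hU]

theorem le_of_forall_le_one_add_pow_mul {a b : ℝ≥0∞} (k : ℕ)
    (h : ∀ δ : NNReal, 0 < δ → a ≤ (1 + δ : ℝ≥0∞) ^ k * b) : a ≤ b := by
  have hc : Continuous fun δ : NNReal => (1 + δ : NNReal) ^ k := by fun_prop
  have h1 : Filter.Tendsto (fun δ : NNReal => (((1 + δ : NNReal) ^ k : NNReal) : ℝ≥0∞))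
      (𝓝[>] 0) (𝓝 1) := by
    have h0 := hc.tendsto 0
    simp only [add_zero, one_pow] at h0
    exact (ENNReal.tendsto_coe.2 h0).mono_left nhdsWithin_le_nhds
  have h2 := ENNReal.Tendsto.mul_const (b := b) h1 (Or.inl one_ne_zero)
  rw [one_mul] at h2
  refine ge_of_tendsto h2 ?_
  filter_upwards [self_mem_nhdsWithin] with δ hδ
  simpa using h δ hδ

namespace Frame

variable {d : ℕ} (Φ : Frame d)

theorem areaFactor_le (ℓ ℓ' : Base d →L[ℝ] ℝ) : areaFactor ℓ ≤ areaFactor ℓ' + ‖ℓ - ℓ'‖ := by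
  have h1 : ‖ℓ‖ ≤ ‖ℓ'‖ + ‖ℓ - ℓ'‖ := by
    simpa using norm_add_le ℓ' (ℓ - ℓ')
  have h2 : ‖ℓ'‖ ≤ areaFactor ℓ' := Real.le_sqrt_of_sq_le (by linarith)
  have h3 : areaFactor ℓ' ^ 2 = 1 + ‖ℓ'‖ ^ 2 := Real.sq_sqrt (by positivity)
  have h4 := one_le_areaFactor ℓ'
  rw [areaFactor, Real.sqrt_le_left (by positivity)]
  nlinarith [norm_nonneg ℓ, norm_nonneg ℓ', norm_nonneg (ℓ - ℓ'),
    mul_le_mul_of_nonneg_right h2 (norm_nonneg (ℓ - ℓ'))]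

theorem areaFactor_le_mul {ℓ ℓ' : Base d →L[ℝ] ℝ} {δ : NNReal} (h : ‖ℓ - ℓ'‖ ≤ δ) :
    ENNReal.ofReal (areaFactor ℓ) ≤ (1 + δ : ℝ≥0∞) * ENNReal.ofReal (areaFactor ℓ') := by
  have h1 := areaFactor_le ℓ ℓ'
  have h4 := one_le_areaFactor ℓ'
  have : (1 + δ : ℝ≥0∞) = ENNReal.ofReal (1 + (δ : ℝ)) := by
    rw [ENNReal.ofReal_add zero_le_one δ.coe_nonneg]; simp
  rw [this, ← ENNReal.ofReal_mul (by positivity)]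
  refine ENNReal.ofReal_le_ofReal ?_
  nlinarith [δ.coe_nonneg, mul_le_mul_of_nonneg_left h4 δ.coe_nonneg]

/-- On a set where the graph map is close to a linear graph map, surface areas of the images
under both are comparable; the comparison goes through the projection onto the hyperplane, which
inverts both maps without increasing distances. -/
theorem area_image_comparable {f : Base d → ℝ} {ℓ : Base d →L[ℝ] ℝ} {δ : NNReal} {p : Set (Base d)}
    (h : ApproximatesLinearOn (Φ.graphMap f) (Φ.graphDeriv ℓ) p δ) :
    (μHE[d] : Measure (Space d)) (Φ.graphMap f '' p) ≤
        (1 + δ : ℝ≥0∞) ^ d * (μHE[d] : Measure (Space d)) (Φ.graphDeriv ℓ '' p) ∧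
      (μHE[d] : Measure (Space d)) (Φ.graphDeriv ℓ '' p) ≤
        (1 + δ : ℝ≥0∞) ^ d * (μHE[d] : Measure (Space d)) (Φ.graphMap f '' p) := by
  have hproj : ∀ u, Φ.proj (Φ.graphDeriv ℓ u) = u := fun u => by rw [graphDeriv_apply, proj_pt]
  have key : ∀ u ∈ p, ∀ v ∈ p,
      ‖(Φ.graphMap f u - Φ.graphMap f v) - (Φ.graphDeriv ℓ u - Φ.graphDeriv ℓ v)‖
        ≤ δ * ‖u - v‖ := fun u hu v hv => by
    have := h u hu v hv
    rwa [map_sub] at this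
  constructor
  · have hL : LipschitzOnWith (1 + δ) (Φ.graphMap f ∘ Φ.proj) (Φ.graphDeriv ℓ '' p) := by
      refine LipschitzOnWith.of_dist_le_mul ?_
      rintro _ ⟨u, hu, rfl⟩ _ ⟨v, hv, rfl⟩
      simp only [Function.comp, hproj, dist_eq_norm]
      have h1 := key u hu v hv
      have h2 : ‖u - v‖ ≤ ‖Φ.graphDeriv ℓ u - Φ.graphDeriv ℓ v‖ := by
        rw [← map_sub]; exact Φ.norm_le_norm_graphDeriv ℓ _
      have h3 := norm_sub_norm_le (Φ.graphMap f u - Φ.graphMap f v)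
        (Φ.graphDeriv ℓ u - Φ.graphDeriv ℓ v)
      have h4 := mul_le_mul_of_nonneg_left h2 δ.coe_nonneg
      rw [NNReal.coe_add, NNReal.coe_one, add_mul, one_mul]
      exact (sub_le_iff_le_add'.1 (h3.trans (h1.trans h4)))
    have := area_image_le d hL
    rw [image_image] at this
    simpa [hproj] using this
  · have hL : LipschitzOnWith (1 + δ) (Φ.graphDeriv ℓ ∘ Φ.proj) (Φ.graphMap f '' p) := by
      refine LipschitzOnWith.of_dist_le_mul ?_
      rintro _ ⟨u, hu, rfl⟩ _ ⟨v, hv, rfl⟩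
      simp only [Function.comp, proj_graphMap, dist_eq_norm]
      have h1 := key u hu v hv
      have h2 : ‖u - v‖ ≤ ‖Φ.graphMap f u - Φ.graphMap f v‖ := by
        have h := Φ.norm_fst_le ((u, f u) - (v, f v))
        rwa [Prod.fst_sub, ← pt_sub] at h
      have h3 := norm_sub_norm_le (Φ.graphDeriv ℓ u - Φ.graphDeriv ℓ v)
        (Φ.graphMap f u - Φ.graphMap f v)
      rw [norm_sub_rev] at h1
      have h4 := mul_le_mul_of_nonneg_left h2 δ.coe_nonneg
      rw [NNReal.coe_add, NNReal.coe_one, add_mul, one_mul]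
      exact (sub_le_iff_le_add'.1 (h3.trans (h1.trans h4)))
    have := area_image_le d hL
    rw [image_image] at this
    simpa using this

theorem lipschitz_graphMap {f : Base d → ℝ} {K : NNReal} (hf : LipschitzWith K f) :
    LipschitzWith (1 + K) (Φ.graphMap f) := by
  refine LipschitzWith.of_dist_le_mul fun u v => ?_
  have h1 := hf.dist_le_mul u v
  rw [dist_eq_norm, Real.norm_eq_abs, dist_eq_norm] at h1
  rw [dist_eq_norm, dist_eq_norm, graphMap, graphMap, pt_sub, pt]
  refine (norm_add_le _ _).trans ?_
  rw [Φ.base.norm_map, norm_smul, Φ.norm_axis]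
  simp only [Prod.fst_sub, Prod.snd_sub, Real.norm_eq_abs]
  push_cast
  linarith

theorem area_image_null {f : Base d → ℝ} {K : NNReal} (hf : LipschitzWith K f) {s : Set (Base d)}
    (hs : volume s = 0) : (μHE[d] : Measure (Space d)) (Φ.graphMap f '' s) = 0 := by
  refine le_antisymm
    ((area_image_le d ((Φ.lipschitz_graphMap hf).lipschitzOnWith (s := s))).trans ?_) (zero_le)
  rw [EuclideanSpace.euclideanHausdorffMeasure_eq_volume, hs, mul_zero]

/-- The area formula for the graph of a Lipschitz function. -/
theorem area_image_graphMap {f : Base d → ℝ} {K : NNReal} (hf : LipschitzWith K f)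
    {s : Set (Base d)} (hs : MeasurableSet s) :
    (μHE[d] : Measure (Space d)) (Φ.graphMap f '' s) =
      ∫⁻ u in s, ENNReal.ofReal (areaFactor (fderiv ℝ f u)) := by
  have hemb := (Φ.isClosedEmbedding_graphMap hf.continuous).measurableEmbedding
  have hJ : Measurable fun u => ENNReal.ofReal (areaFactor (fderiv ℝ f u)) := by
    unfold areaFactor
    have := measurable_fderiv ℝ f
    fun_prop
  set m₁ : Measure (Base d) := (μHE[d] : Measure (Space d)).comap (Φ.graphMap f) with hm₁
  set m₂ : Measure (Base d) :=
    volume.withDensity fun u => ENNReal.ofReal (areaFactor (fderiv ℝ f u)) with hm₂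
  have hm₁a : ∀ t, m₁ t = (μHE[d] : Measure (Space d)) (Φ.graphMap f '' t) :=
    fun t => hemb.comap_apply _ t
  have hD : MeasurableSet {u | DifferentiableAt ℝ f u} := measurableSet_of_differentiableAt ℝ f
  -- on pieces where the derivative hardly varies, both measures are comparable
  have small : ∀ (δ : NNReal), 0 < δ → ∀ (c : Base d →L[ℝ] ℝ) (p : Set (Base d)), MeasurableSet p →
      (∀ u ∈ p, DifferentiableAt ℝ f u ∧ dist (fderiv ℝ f u) c < δ) →
      m₁ p ≤ (1 + (2 * δ : NNReal) : ℝ≥0∞) ^ (d + 1) * m₂ p ∧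
        m₂ p ≤ (1 + (2 * δ : NNReal) : ℝ≥0∞) ^ (d + 1) * m₁ p := by
    intro δ hδ c p hp hpd
    rcases p.eq_empty_or_nonempty with rfl | hne
    · simp
    obtain ⟨t, A, htd, htm, hst, htA, hA⟩ :=
      exists_partition_approximatesLinearOn_of_hasFDerivWithinAt (Φ.graphMap f) p
        (fun u => Φ.graphDeriv (fderiv ℝ f u))
        (fun u hu => (Φ.hasFDerivAt_graphMap (hpd u hu).1.hasFDerivAt).hasFDerivWithinAt)
        (fun _ => δ) (fun _ => hδ.ne')
    have hle : (1 + (δ : NNReal) : ℝ≥0∞) ≤ 1 + (2 * δ : NNReal) := by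
      gcongr
      rw [two_mul]; exact le_self_add
    have piece : ∀ n, m₁ (p ∩ t n) ≤
        (1 + (2 * δ : NNReal) : ℝ≥0∞) ^ (d + 1) * m₂ (p ∩ t n) ∧
        m₂ (p ∩ t n) ≤ (1 + (2 * δ : NNReal) : ℝ≥0∞) ^ (d + 1) * m₁ (p ∩ t n) := by
      intro n
      have hmeas : MeasurableSet (p ∩ t n) := hp.inter (htm n)
      obtain ⟨y, hy, hAy⟩ := hA hne n
      set ℓ := fderiv ℝ f y
      have hap := htA n
      rw [hAy] at hap
      obtain ⟨c₁, c₂⟩ := Φ.area_image_comparable hap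
      rw [Φ.area_image_graphDeriv] at c₁ c₂
      have hclose : ∀ u ∈ p ∩ t n, ‖ℓ - fderiv ℝ f u‖ ≤ (2 * δ : NNReal) := fun u hu => by
        have h1 := (hpd u hu.1).2
        have h2 := (hpd y hy).2
        have h3 := dist_triangle_right ℓ (fderiv ℝ f u) c
        rw [← dist_eq_norm]
        push_cast
        linarith
      have b₁ : ENNReal.ofReal (areaFactor ℓ) * volume (p ∩ t n) ≤
          (1 + (2 * δ : NNReal) : ℝ≥0∞) * m₂ (p ∩ t n) := by
        rw [hm₂, withDensity_apply _ hmeas, ← lintegral_const_mul _ hJ, ← setLIntegral_const]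
        exact setLIntegral_mono' hmeas fun u hu => areaFactor_le_mul (hclose u hu)
      have b₂ : m₂ (p ∩ t n) ≤ (1 + (2 * δ : NNReal) : ℝ≥0∞) *
          (ENNReal.ofReal (areaFactor ℓ) * volume (p ∩ t n)) := by
        rw [hm₂, withDensity_apply _ hmeas, ← mul_assoc, ← setLIntegral_const]
        refine setLIntegral_mono' hmeas fun u hu => areaFactor_le_mul ?_
        rw [norm_sub_rev]; exact hclose u hu
      rw [← hm₁a] at c₁ c₂
      constructor
      · calc m₁ (p ∩ t n) ≤ (1 + δ) ^ d * (ENNReal.ofReal (areaFactor ℓ) * volume (p ∩ t n)) := c₁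
          _ ≤ (1 + (2 * δ : NNReal)) ^ d * ((1 + (2 * δ : NNReal) : ℝ≥0∞) * m₂ (p ∩ t n)) := by
            gcongr
          _ = _ := by rw [pow_succ, mul_assoc]
      · calc m₂ (p ∩ t n) ≤ _ := b₂
          _ ≤ (1 + (2 * δ : NNReal) : ℝ≥0∞) * ((1 + (2 * δ : NNReal)) ^ d * m₁ (p ∩ t n)) := by
            exact mul_le_mul_right (c₂.trans (by gcongr)) _
          _ = _ := by rw [pow_succ']; ring
    exact ⟨measure_le_mul_of_countable_cover hp htm htd hst _ fun n => (piece n).1,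
      measure_le_mul_of_countable_cover hp htm htd hst _ fun n => (piece n).2⟩
  -- a countable partition according to the value of the derivative
  have large : ∀ (δ : NNReal), 0 < δ → ∀ (p : Set (Base d)), MeasurableSet p →
      (∀ u ∈ p, DifferentiableAt ℝ f u) →
      m₁ p ≤ (1 + (2 * δ : NNReal) : ℝ≥0∞) ^ (d + 1) * m₂ p ∧
        m₂ p ≤ (1 + (2 * δ : NNReal) : ℝ≥0∞) ^ (d + 1) * m₁ p := by
    intro δ hδ p hp hpd
    let c := TopologicalSpace.denseSeq (Base d →L[ℝ] ℝ)
    let b : ℕ → Set (Base d) := fun n => fderiv ℝ f ⁻¹' Metric.ball (c n) δ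
    have hb : ∀ n, MeasurableSet (b n) := fun n =>
      measurable_fderiv ℝ f Metric.isOpen_ball.measurableSet
    have hcov : p ⊆ ⋃ n, disjointed b n := by
      rw [iUnion_disjointed]
      intro u _
      obtain ⟨n, hn⟩ := (TopologicalSpace.denseRange_denseSeq (Base d →L[ℝ] ℝ)).exists_dist_lt
        (fderiv ℝ f u) (NNReal.coe_pos.2 hδ)
      exact mem_iUnion.2 ⟨n, hn⟩
    have hpiece := fun n => small δ hδ (c n) (p ∩ disjointed b n)
      (hp.inter (MeasurableSet.disjointed hb n))
      fun u hu => ⟨hpd u hu.1, (disjointed_subset b n) hu.2⟩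
    exact ⟨measure_le_mul_of_countable_cover hp (MeasurableSet.disjointed hb)
        (disjoint_disjointed b) hcov _ fun n => (hpiece n).1,
      measure_le_mul_of_countable_cover hp (MeasurableSet.disjointed hb)
        (disjoint_disjointed b) hcov _ fun n => (hpiece n).2⟩
  have diff : ∀ p : Set (Base d), MeasurableSet p → (∀ u ∈ p, DifferentiableAt ℝ f u) →
      m₁ p = m₂ p := by
    intro p hp hpd
    have half : ∀ δ : NNReal, 2 * (δ / 2) = δ := fun δ => mul_div_cancel₀ δ two_ne_zero
    refine le_antisymm (le_of_forall_le_one_add_pow_mul (d + 1) fun δ hδ => ?_)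
      (le_of_forall_le_one_add_pow_mul (d + 1) fun δ hδ => ?_)
    · simpa [half] using (large (δ / 2) (half_pos hδ) p hp hpd).1
    · simpa [half] using (large (δ / 2) (half_pos hδ) p hp hpd).2
  have hnull : volume {u | DifferentiableAt ℝ f u}ᶜ = 0 := hf.ae_differentiableAt
  have h1 : m₁ (s \ {u | DifferentiableAt ℝ f u}) = 0 := by
    rw [hm₁a]
    exact Φ.area_image_null hf (measure_mono_null (fun u hu => hu.2) hnull)
  have h2 : m₂ (s \ {u | DifferentiableAt ℝ f u}) = 0 :=
    withDensity_absolutelyContinuous _ _ (measure_mono_null (fun u hu => hu.2) hnull)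
  rw [← hm₁a, ← withDensity_apply _ hs, ← hm₂, ← measure_inter_add_sdiff s hD, h1,
    ← measure_inter_add_sdiff (μ := m₂) s hD, h2, diff _ (hs.inter hD) fun u hu => hu.2]

/-- Integration over the graph of a Lipschitz function. -/
theorem lintegral_range_graphMap {f : Base d → ℝ} {K : NNReal} (hf : LipschitzWith K f)
    (g : Space d → ℝ≥0∞) :
    ∫⁻ x in range (Φ.graphMap f), g x ∂μHE[d] =
      ∫⁻ u, ENNReal.ofReal (areaFactor (fderiv ℝ f u)) * g (Φ.graphMap f u) := by
  have hemb := (Φ.isClosedEmbedding_graphMap hf.continuous).measurableEmbedding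
  have hJ : Measurable fun u => ENNReal.ofReal (areaFactor (fderiv ℝ f u)) := by
    unfold areaFactor
    have := measurable_fderiv ℝ f
    fun_prop
  have : (μHE[d] : Measure (Space d)).restrict (range (Φ.graphMap f)) =
      (volume.withDensity fun u => ENNReal.ofReal (areaFactor (fderiv ℝ f u))).map
        (Φ.graphMap f) := by
    ext t ht
    rw [hemb.map_apply, Measure.restrict_apply ht,
      withDensity_apply _ (hemb.measurable ht), ← Φ.area_image_graphMap hf (hemb.measurable ht),
      image_preimage_eq_inter_range]
  rw [this, hemb.lintegral_map, lintegral_withDensity_eq_lintegral_mul_non_measurable _ hJ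
    (Filter.Eventually.of_forall fun u => ENNReal.ofReal_lt_top)]
  rfl

end Frame

variable {d : ℕ}

/-! ### The octant -/

theorem abs_apply_le_norm (x : Space d) (i : Fin (d + 1)) : |x i| ≤ ‖x‖ := by
  simpa using PiLp.norm_apply_le x i

theorem continuous_apply' (i : Fin (d + 1)) : Continuous fun x : Space d => x i := by fun_prop

theorem isClosed_octant : IsClosed (octant d) := by
  have : octant d = ⋂ i, {x : Space d | 0 ≤ x i} := by ext; simp [octant]
  rw [this]
  exact isClosed_iInter fun i => isClosed_le continuous_const (continuous_apply' i)

theorem add_mem_octant {x y : Space d} (hx : x ∈ octant d) (hy : y ∈ octant d) :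
    x + y ∈ octant d := fun i => add_nonneg (hx i) (hy i)

theorem smul_mem_octant {c : ℝ} (hc : 0 ≤ c) {x : Space d} (hx : x ∈ octant d) :
    c • x ∈ octant d := fun i => mul_nonneg hc (hx i)

theorem inner_nonneg_of_mem_octant {x y : Space d} (hx : x ∈ octant d) (hy : y ∈ octant d) :
    0 ≤ inner ℝ x y := by
  rw [PiLp.inner_apply]
  exact Finset.sum_nonneg fun i _ => by simpa using mul_nonneg (hy i) (hx i)

/-- The open positive octant. -/
def posOctant (d : ℕ) : Set (Space d) := {x | ∀ i, 0 < x i}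

theorem posOctant_subset_octant : posOctant d ⊆ octant d := fun _ hx i => (hx i).le

theorem isOpen_setOf_forall_lt (x : Space d) : IsOpen {z : Space d | ∀ i, x i < z i} := by
  have : {z : Space d | ∀ i, x i < z i} = ⋂ i, {z : Space d | x i < z i} := by ext; simp
  rw [this]
  exact isOpen_iInter_of_finite fun i => isOpen_lt continuous_const (continuous_apply' i)

theorem isOpen_posOctant : IsOpen (posOctant d) := isOpen_setOf_forall_lt 0

theorem smul_mem_posOctant {c : ℝ} (hc : 0 < c) {x : Space d} (hx : x ∈ posOctant d) :
    c • x ∈ posOctant d := fun i => mul_pos hc (hx i)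

theorem inner_pos_of_mem_posOctant {x y : Space d} (hx : x ∈ posOctant d) (hy : y ∈ octant d)
    (hy0 : y ≠ 0) : 0 < inner ℝ x y := by
  rw [PiLp.inner_apply]
  obtain ⟨i, hi⟩ : ∃ i, y i ≠ 0 := by
    by_contra! h
    exact hy0 (by ext i; exact h i)
  refine Finset.sum_pos' (fun i _ => by simpa using mul_nonneg (hy i) (hx i).le)
    ⟨i, Finset.mem_univ i, by simpa using mul_pos (lt_of_le_of_ne (hy i) (Ne.symm hi)) (hx i)⟩

/-- The vector with all coordinates equal to `1`. -/
def ones (d : ℕ) : Space d := WithLp.toLp 2 fun _ => (1 : ℝ)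

@[simp] theorem ones_apply (i : Fin (d + 1)) : ones d i = 1 := rfl

theorem ones_mem_posOctant : ones d ∈ posOctant d := fun i => by simp

theorem norm_ones_pos : 0 < ‖ones d‖ := by
  rw [norm_pos_iff]
  intro h
  simpa using congrArg (fun x : Space d => x 0) h

/-- A set that is stable under the addition of vectors of the octant is connected: any two points
can go up to their coordinatewise maximum. -/
theorem isPreconnected_of_add_mem {S : Set (Space d)}
    (hS : ∀ x ∈ S, ∀ y ∈ octant d, x + y ∈ S) : IsPreconnected S := by
  have hseg : ∀ x ∈ S, ∀ z : Space d, z - x ∈ octant d → segment ℝ x z ⊆ S := by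
    intro x hx z hz w hw
    rw [segment_eq_image'] at hw
    obtain ⟨t, ht, rfl⟩ := hw
    exact hS x hx _ (smul_mem_octant ht.1 hz)
  refine isPreconnected_of_forall_pair fun x hx y hy => ?_
  let z : Space d := WithLp.toLp 2 fun i => max (x i) (y i)
  have hxz : z - x ∈ octant d := fun i => by simp [z]
  have hyz : z - y ∈ octant d := fun i => by simp [z]
  refine ⟨segment ℝ x z ∪ segment ℝ y z, union_subset (hseg x hx z hxz) (hseg y hy z hyz),
    Or.inl (left_mem_segment ℝ x z), Or.inr (left_mem_segment ℝ y z), ?_⟩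
  exact IsPreconnected.union z (right_mem_segment ℝ x z) (right_mem_segment ℝ y z)
    (convex_segment x z).isPreconnected (convex_segment y z).isPreconnected

theorem isPreconnected_of_sub_mem {S : Set (Space d)}
    (hS : ∀ x ∈ S, ∀ y ∈ octant d, x - y ∈ S) : IsPreconnected S := by
  have h : IsPreconnected (-S) := isPreconnected_of_add_mem fun x hx y hy => by
    have := hS (-x) hx y hy
    rwa [Set.mem_neg, neg_add, ← sub_eq_add_neg]
  have := h.image (fun x => -x) continuous_neg.continuousOn
  rwa [Set.image_neg_eq_neg, neg_neg] at this

theorem isPreconnected_compl_octant : IsPreconnected (octant d)ᶜ := by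
  refine isPreconnected_of_sub_mem fun x hx y hy h => hx ?_
  simpa using add_mem_octant h hy

theorem outerPoint_notMem_octant : outerPoint d ∉ octant d := fun h => by
  have := h 0
  simp [outerPoint] at this
  linarith

/-! ### Normal vectors -/

theorem IsNormalAt.eventually_mem {G : Set (Space d)} {x n : Space d} (h : IsNormalAt G x n)
    (v : Space d) : ∀ᶠ t : ℝ in 𝓝[>] 0, (0 < inner ℝ v n → x + t • v ∈ upperPart G) ∧
      (inner ℝ v n < 0 → x + t • v ∈ lowerPart G) := by
  by_cases h0 : inner ℝ v n = 0
  · simp [h0]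
  have hε : 0 < |inner ℝ v n| / (2 * (‖v‖ + 1)) := by positivity
  have hlim : Filter.Tendsto (fun t : ℝ => x + t • v) (𝓝[>] 0) (𝓝 x) := by
    have : Continuous fun t : ℝ => x + t • v := by fun_prop
    have := this.tendsto 0
    simp only [zero_smul, add_zero] at this
    exact this.mono_left nhdsWithin_le_nhds
  have key : |inner ℝ v n| / (2 * (‖v‖ + 1)) * ‖v‖ < |inner ℝ v n| := by
    rw [div_mul_eq_mul_div, div_lt_iff₀ (by positivity)]
    nlinarith [abs_pos.2 h0, norm_nonneg v, mul_nonneg (abs_nonneg (inner ℝ v n)) (norm_nonneg v)]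
  filter_upwards [hlim.eventually (h.2 _ hε), self_mem_nhdsWithin] with t ht ht0
  have ht0 : 0 < t := ht0
  have e1 : x + t • v - x = t • v := by abel
  rw [e1, norm_smul, Real.norm_of_nonneg ht0.le, inner_smul_left] at ht
  simp only [conj_trivial] at ht
  refine ⟨fun hp => ht.1 ?_, fun hn => ht.2 ?_⟩
  · rw [abs_of_pos hp] at key ⊢
    nlinarith [mul_lt_mul_of_pos_left key ht0]
  · rw [abs_of_neg hn] at key ⊢
    nlinarith [mul_lt_mul_of_pos_left key ht0]

theorem IsNormalAt.eventually_mem_upperPart {G : Set (Space d)} {x n : Space d}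
    (h : IsNormalAt G x n) {v : Space d} (hv : 0 < inner ℝ v n) :
    ∀ᶠ t : ℝ in 𝓝[>] 0, x + t • v ∈ upperPart G :=
  (h.eventually_mem v).mono fun _ ht => ht.1 hv

theorem IsNormalAt.eventually_mem_lowerPart {G : Set (Space d)} {x n : Space d}
    (h : IsNormalAt G x n) {v : Space d} (hv : inner ℝ v n < 0) :
    ∀ᶠ t : ℝ in 𝓝[>] 0, x + t • v ∈ lowerPart G :=
  (h.eventually_mem v).mono fun _ ht => ht.2 hv

theorem IsNormalAt.unique {G : Set (Space d)} {x n m : Space d} (hn : IsNormalAt G x n)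
    (hm : IsNormalAt G x m) : n = m := by
  by_contra hne
  have hlt : inner ℝ n m < (1 : ℝ) := (inner_lt_one_iff_real_of_norm_eq_one hn.1 hm.1).2 hne
  have h1 : 0 < inner ℝ (n - m) n := by
    rw [inner_sub_left, real_inner_self_eq_norm_sq, hn.1, real_inner_comm]; linarith
  have h2 : inner ℝ (n - m) m < 0 := by
    rw [inner_sub_left, real_inner_self_eq_norm_sq, hm.1]; linarith
  obtain ⟨t, ht1, ht2⟩ :=
    ((hn.eventually_mem_upperPart h1).and (hm.eventually_mem_lowerPart h2)).exists
  exact ht1 (Or.inr ht2)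

theorem IsNormalAt.normal_eq {G : Set (Space d)} {x n : Space d} (h : IsNormalAt G x n) :
    normal G x = n := by
  have hex : ∃ n, IsNormalAt G x n := ⟨n, h⟩
  rw [normal, dif_pos hex]
  exact hex.choose_spec.unique h

/-! ### Upper bodies -/

/-- The bodies that lie above monotone surfaces: the nonempty closed subsets of the octant that
are stable under the addition of vectors of the octant. -/
structure IsUpperBody (C : Set (Space d)) : Prop where
  isClosed : IsClosed C
  nonempty : C.Nonempty
  subset_octant : C ⊆ octant d
  add_mem : ∀ x ∈ C, ∀ y ∈ octant d, x + y ∈ C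

namespace IsUpperBody

variable {C : Set (Space d)} (hC : IsUpperBody C)
include hC

theorem mem_of_forall_le {x y : Space d} (hx : x ∈ C) (h : ∀ i, x i ≤ y i) : y ∈ C := by
  have := hC.add_mem x hx (y - x) fun i => by simpa using h i
  simpa using this

theorem add_mem_interior {x y : Space d} (hx : x ∈ C) (hy : y ∈ posOctant d) :
    x + y ∈ interior C :=
  mem_interior.2 ⟨{z | ∀ i, x i < z i}, fun _ hz => hC.mem_of_forall_le hx fun i => (hz i).le,
    isOpen_setOf_forall_lt x, fun i => by simpa using hy i⟩

theorem interior_subset_posOctant : interior C ⊆ posOctant d := by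
  intro x hx i
  have hc : Continuous fun t : ℝ => x - t • ones d := by fun_prop
  have h0 : (fun t : ℝ => x - t • ones d) 0 ∈ interior C := by simpa using hx
  have h1 : ∀ᶠ t : ℝ in 𝓝[>] 0, x - t • ones d ∈ interior C :=
    (hc.continuousAt.eventually (isOpen_interior.mem_nhds h0)).filter_mono nhdsWithin_le_nhds
  obtain ⟨t, ht, ht0⟩ := (h1.and self_mem_nhdsWithin).exists
  have ht0 : 0 < t := ht0
  have := hC.subset_octant (interior_subset ht) i
  simp at this
  linarith

theorem closure_interior : closure (interior C) = C := by
  refine (closure_minimal interior_subset hC.isClosed).antisymm fun x hx => ?_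
  have hc : Continuous fun t : ℝ => x + t • ones d := by fun_prop
  have h1 : Filter.Tendsto (fun t : ℝ => x + t • ones d) (𝓝[>] 0) (𝓝 x) := by
    have := hc.tendsto 0
    simp only [zero_smul, add_zero] at this
    exact this.mono_left nhdsWithin_le_nhds
  refine mem_closure_of_tendsto h1 ?_
  filter_upwards [self_mem_nhdsWithin] with t ht
  exact hC.add_mem_interior hx (smul_mem_posOctant ht ones_mem_posOctant)

theorem frontier_eq : frontier C = C \ interior C := by
  rw [frontier, hC.isClosed.closure_eq]

theorem frontier_subset_octant : frontier C ⊆ octant d := fun _ hx =>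
  hC.subset_octant (hC.frontier_eq ▸ hx).1

theorem nonempty_interior : (interior C).Nonempty := by
  obtain ⟨x, hx⟩ := hC.nonempty
  exact ⟨_, hC.add_mem_interior hx ones_mem_posOctant⟩

theorem isConnected_interior : IsConnected (interior C) := by
  refine ⟨hC.nonempty_interior, isPreconnected_of_add_mem fun x hx y hy => ?_⟩
  obtain ⟨U, hUC, hU, hxU⟩ := mem_interior.1 hx
  refine mem_interior.2 ⟨(fun z => z - y) ⁻¹' U, fun z hz => ?_, hU.preimage (by fun_prop), ?_⟩
  · simpa using hC.add_mem _ (hUC hz) y hy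
  · simpa using hxU

theorem isPreconnected_compl : IsPreconnected Cᶜ :=
  isPreconnected_of_sub_mem fun x hx y hy h => hx (by simpa using hC.add_mem _ h y hy)

theorem outerPoint_mem_compl : outerPoint d ∈ Cᶜ :=
  fun h => outerPoint_notMem_octant (hC.subset_octant h)

theorem lowerPart_frontier : lowerPart (frontier C) = Cᶜ := by
  have hsub : Cᶜ ⊆ (frontier C)ᶜ := compl_subset_compl.2 (hC.frontier_eq ▸ sdiff_subset)
  refine Subset.antisymm ?_ (hC.isPreconnected_compl.subset_connectedComponentIn
    hC.outerPoint_mem_compl hsub)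
  refine isPreconnected_connectedComponentIn.subset_left_of_subset_union
    (v := interior C) hC.isClosed.isOpen_compl isOpen_interior
    (disjoint_compl_left.mono_right interior_subset) ?_
    ⟨outerPoint d, mem_connectedComponentIn (hsub hC.outerPoint_mem_compl),
      hC.outerPoint_mem_compl⟩
  refine (connectedComponentIn_subset _ _).trans fun x hx => ?_
  rw [hC.frontier_eq] at hx
  by_cases h : x ∈ C
  · exact Or.inr (not_not.1 fun hi => hx ⟨h, hi⟩)
  · exact Or.inl h

theorem upperPart_frontier : upperPart (frontier C) = interior C := by
  rw [upperPart, hC.lowerPart_frontier, hC.frontier_eq]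
  ext x
  simp only [mem_compl_iff, mem_union, mem_sdiff]
  have := @interior_subset _ _ C x
  tauto

theorem body_frontier : body (frontier C) = octant d \ C := by
  rw [body, hC.lowerPart_frontier]; rfl

theorem inner_nonneg_of_isNormalAt {x n v : Space d} (hx : x ∈ C)
    (h : IsNormalAt (frontier C) x n) (hv : v ∈ octant d) : 0 ≤ inner ℝ v n := by
  by_contra! hneg
  obtain ⟨t, ht, ht0⟩ := ((h.eventually_mem_lowerPart hneg).and self_mem_nhdsWithin).exists
  rw [hC.lowerPart_frontier] at ht
  exact ht (hC.add_mem x hx _ (smul_mem_octant (le_of_lt ht0) hv))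

theorem isNormalAt_mem_sphericalOctant {x n : Space d} (hx : x ∈ C)
    (h : IsNormalAt (frontier C) x n) : n ∈ sphericalOctant d := by
  refine ⟨by simpa using h.1, fun i => ?_⟩
  have := hC.inner_nonneg_of_isNormalAt hx h (v := EuclideanSpace.single i 1) fun j => by
    simp only [PiLp.single_apply]; split_ifs <;> norm_num
  simpa [EuclideanSpace.inner_single_left] using this

/-- If an upper body lies locally in a half-space through one of its boundary points, then this
half-space is determined by the normal vector. -/
theorem isNormalAt_eq_of_forall_inner {x n m : Space d} (h : IsNormalAt (frontier C) x n)
    (hm : ‖m‖ = 1) (hle : ∀ y ∈ C, inner ℝ x m ≤ inner ℝ y m) : n = m := by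
  by_contra hne
  have hlt : inner ℝ n m < (1 : ℝ) := (inner_lt_one_iff_real_of_norm_eq_one h.1 hm).2 hne
  have h1 : 0 < inner ℝ (n - m) n := by
    rw [inner_sub_left, real_inner_self_eq_norm_sq, h.1, real_inner_comm]; linarith
  have h2 : inner ℝ (n - m) m < 0 := by
    rw [inner_sub_left, real_inner_self_eq_norm_sq, hm]; linarith
  obtain ⟨t, ht, ht0⟩ := ((h.eventually_mem_upperPart h1).and self_mem_nhdsWithin).exists
  have ht0 : 0 < t := ht0
  rw [hC.upperPart_frontier] at ht
  have := hle _ (interior_subset ht)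
  rw [inner_add_left, inner_smul_left] at this
  simp only [conj_trivial] at this
  nlinarith

end IsUpperBody

/-! ### Upper bodies as epigraphs -/

theorem exists_diagFrame (d : ℕ) : ∃ Φ : Frame d, Φ.axis = ‖ones d‖⁻¹ • ones d :=
  Frame.exists_axis_eq _ (by
    rw [norm_smul, norm_inv, norm_norm, inv_mul_cancel₀ norm_ones_pos.ne'])

/-- A frame whose axis is the diagonal direction. -/
def diagFrame (d : ℕ) : Frame d := (exists_diagFrame d).choose

theorem diagFrame_axis : (diagFrame d).axis = ‖ones d‖⁻¹ • ones d :=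
  (exists_diagFrame d).choose_spec

theorem diagFrame_axis_apply (i : Fin (d + 1)) : (diagFrame d).axis i = ‖ones d‖⁻¹ := by
  rw [diagFrame_axis]; simp

theorem diagFrame_axis_mem : (diagFrame d).axis ∈ posOctant d := fun i => by
  rw [diagFrame_axis_apply]; exact inv_pos.2 norm_ones_pos

theorem diagFrame_pt_apply (p : Base d × ℝ) (i : Fin (d + 1)) :
    (diagFrame d).pt p i = (diagFrame d).base p.1 i + p.2 * ‖ones d‖⁻¹ := by
  simp [Frame.pt, diagFrame_axis_apply]

/-- The function whose epigraph, over the hyperplane orthogonal to the diagonal, is the set. -/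
def profile (C : Set (Space d)) (u : Base d) : ℝ := sInf {t | (diagFrame d).pt (u, t) ∈ C}

namespace IsUpperBody

variable {C : Set (Space d)} (hC : IsUpperBody C)
include hC

theorem pt_mem_iff (u : Base d) (t : ℝ) : (diagFrame d).pt (u, t) ∈ C ↔ profile C u ≤ t := by
  have hclosed : IsClosed {t | (diagFrame d).pt (u, t) ∈ C} :=
    hC.isClosed.preimage ((diagFrame d).ptL.continuous.comp (Continuous.prodMk_right u))
  have hbdd : BddBelow {t | (diagFrame d).pt (u, t) ∈ C} := by
    refine ⟨0, fun t ht => ?_⟩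
    have := inner_nonneg_of_mem_octant (hC.subset_octant ht)
      (posOctant_subset_octant diagFrame_axis_mem)
    rwa [Frame.inner_pt_axis] at this
  have hne : {t | (diagFrame d).pt (u, t) ∈ C}.Nonempty := by
    obtain ⟨x, hx⟩ := hC.nonempty
    refine ⟨(‖u‖ + ‖x‖) * ‖ones d‖, hC.mem_of_forall_le hx fun i => ?_⟩
    rw [diagFrame_pt_apply, mul_assoc, mul_inv_cancel₀ norm_ones_pos.ne', mul_one]
    have h1 := abs_apply_le_norm ((diagFrame d).base u) i
    have h2 := abs_apply_le_norm x i
    rw [LinearIsometry.norm_map] at h1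
    have h3 := neg_abs_le ((diagFrame d).base u i)
    have h4 := le_abs_self (x i)
    simp only
    linarith
  refine ⟨fun h => csInf_le hbdd h, fun h => ?_⟩
  refine hC.mem_of_forall_le (hclosed.csInf_mem hne hbdd) fun i => ?_
  rw [diagFrame_pt_apply, diagFrame_pt_apply]
  have := mul_le_mul_of_nonneg_right h (inv_pos.2 (norm_ones_pos (d := d))).le
  simp only [profile] at this ⊢
  linarith

theorem lipschitz_profile : LipschitzWith (‖ones d‖₊) (profile C) := by
  refine LipschitzWith.of_le_add_mul _ fun u v => ?_
  rw [← hC.pt_mem_iff]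
  refine hC.mem_of_forall_le ((hC.pt_mem_iff v _).2 le_rfl) fun i => ?_
  have h1 := abs_apply_le_norm ((diagFrame d).base (v - u)) i
  rw [LinearIsometry.norm_map, map_sub, PiLp.sub_apply, ← dist_eq_norm, dist_comm] at h1
  have h2 := le_abs_self ((diagFrame d).base v i - (diagFrame d).base u i)
  rw [diagFrame_pt_apply, diagFrame_pt_apply]
  have h3 : ‖ones d‖ * dist u v * ‖ones d‖⁻¹ = dist u v := by
    field_simp [norm_ones_pos.ne']
  simp only [coe_nnnorm, add_mul, h3]
  linarith

theorem pt_mem_interior_iff (u : Base d) (t : ℝ) :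
    (diagFrame d).pt (u, t) ∈ interior C ↔ profile C u < t := by
  constructor
  · intro h
    have hO : IsOpen {s | (diagFrame d).pt (u, s) ∈ interior C} :=
      isOpen_interior.preimage ((diagFrame d).ptL.continuous.comp (Continuous.prodMk_right u))
    have hsub : {s | (diagFrame d).pt (u, s) ∈ interior C} ⊆ Ici (profile C u) := fun s hs =>
      (hC.pt_mem_iff u s).1 (interior_subset hs)
    have := interior_maximal hsub hO h
    rwa [interior_Ici] at this
  · intro h
    have h1 := hC.add_mem_interior ((hC.pt_mem_iff u _).2 le_rfl)
      (smul_mem_posOctant (sub_pos.2 h) diagFrame_axis_mem)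
    have h2 : (diagFrame d).pt (u, profile C u) + (t - profile C u) • (diagFrame d).axis
        = (diagFrame d).pt (u, t) := by
      simp only [Frame.pt, sub_smul]; abel
    rwa [h2] at h1

theorem frontier_eq_range : frontier C = range ((diagFrame d).graphMap (profile C)) := by
  ext x
  obtain ⟨⟨u, t⟩, rfl⟩ := (diagFrame d).ptL.surjective x
  rw [hC.frontier_eq, Frame.ptL_apply, mem_sdiff, hC.pt_mem_iff, hC.pt_mem_interior_iff, not_lt]
  constructor
  · rintro ⟨h1, h2⟩
    exact ⟨u, by rw [Frame.graphMap, le_antisymm h1 h2]⟩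
  · rintro ⟨v, hv⟩
    have := (diagFrame d).ptL.injective hv
    obtain ⟨rfl, rfl⟩ := Prod.mk.inj this
    exact ⟨le_rfl, le_rfl⟩

theorem graphMap_mem_frontier (u : Base d) : (diagFrame d).graphMap (profile C) u ∈ frontier C :=
  hC.frontier_eq_range ▸ mem_range_self u

theorem graphMap_mem (u : Base d) : (diagFrame d).graphMap (profile C) u ∈ C :=
  (hC.frontier_eq ▸ hC.graphMap_mem_frontier u).1

theorem nonempty_chartedSpace :
    Nonempty (ChartedSpace (EuclideanSpace ℝ (Fin d)) (frontier C)) := by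
  have hemb := (diagFrame d).isClosedEmbedding_graphMap hC.lipschitz_profile.continuous
  let e : frontier C ≃ₜ EuclideanSpace ℝ (Fin d) :=
    (Homeomorph.setCongr hC.frontier_eq_range).trans hemb.isEmbedding.toHomeomorph.symm
  exact ⟨e.toOpenPartialHomeomorph.singletonChartedSpace (by simp)⟩

end IsUpperBody

/-- The upper unit normal vector of a graph with derivative `ℓ`. -/
def graphNormal (ℓ : Base d →L[ℝ] ℝ) : Space d :=
  (Frame.areaFactor ℓ)⁻¹ •
    (diagFrame d).pt (-(InnerProductSpace.toDual ℝ (Base d)).symm ℓ, 1)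

theorem areaFactor_pos (ℓ : Base d →L[ℝ] ℝ) : 0 < Frame.areaFactor ℓ :=
  zero_lt_one.trans_le (Frame.one_le_areaFactor ℓ)

theorem norm_graphNormal (ℓ : Base d →L[ℝ] ℝ) : ‖graphNormal ℓ‖ = 1 := by
  have h : ‖(diagFrame d).pt (-(InnerProductSpace.toDual ℝ (Base d)).symm ℓ, 1)‖
      = Frame.areaFactor ℓ := by
    rw [Frame.areaFactor, ← Real.sqrt_sq (norm_nonneg ((diagFrame d).pt _)), Frame.norm_pt_sq]
    simp [add_comm]
  rw [graphNormal, norm_smul, h, norm_inv, Real.norm_of_nonneg (areaFactor_pos ℓ).le,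
    inv_mul_cancel₀ (areaFactor_pos ℓ).ne']

theorem areaFactor_mul_inner_graphNormal (ℓ : Base d →L[ℝ] ℝ) (p : Base d × ℝ) :
    Frame.areaFactor ℓ * inner ℝ ((diagFrame d).pt p) (graphNormal ℓ) = p.2 - ℓ p.1 := by
  have h : inner ℝ p.1 ((InnerProductSpace.toDual ℝ (Base d)).symm ℓ) = ℓ p.1 := by
    rw [real_inner_comm, InnerProductSpace.toDual_symm_apply]
  rw [graphNormal, inner_smul_right, mul_inv_cancel_left₀ (areaFactor_pos ℓ).ne']
  simp only [Frame.pt, inner_add_left, inner_add_right, inner_smul_left, inner_smul_right,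
    Frame.inner_base_axis', Frame.inner_axis_base, Frame.inner_axis_axis,
    LinearIsometry.inner_map_map, inner_neg_right, h]
  simp
  ring

namespace IsUpperBody

variable {C : Set (Space d)} (hC : IsUpperBody C)
include hC

theorem isNormalAt_graphMap {u : Base d} {ℓ : Base d →L[ℝ] ℝ} (h : HasFDerivAt (profile C) ℓ u) :
    IsNormalAt (frontier C) ((diagFrame d).graphMap (profile C) u) (graphNormal ℓ) := by
  refine ⟨norm_graphNormal ℓ, fun ε hε => ?_⟩
  have hcont : Filter.Tendsto (diagFrame d).proj (𝓝 ((diagFrame d).graphMap (profile C) u))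
      (𝓝 u) := by
    have := (diagFrame d).continuous_proj.tendsto ((diagFrame d).graphMap (profile C) u)
    rwa [Frame.proj_graphMap] at this
  have hlit := hcont.eventually ((h.isLittleO.def hε))
  filter_upwards [hlit] with y hy
  obtain ⟨⟨v, t⟩, rfl⟩ := (diagFrame d).ptL.surjective y
  rw [Frame.ptL_apply] at hy ⊢
  rw [Frame.proj_pt] at hy
  rw [hC.upperPart_frontier, hC.lowerPart_frontier, mem_compl_iff, hC.pt_mem_interior_iff,
    hC.pt_mem_iff, Frame.graphMap, Frame.pt_sub, not_le]
  have h1 := areaFactor_mul_inner_graphNormal ℓ ((v, t) - (u, profile C u))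
  have h2 := (diagFrame d).norm_fst_le ((v, t) - (u, profile C u))
  have hA := Frame.one_le_areaFactor ℓ
  set A := Frame.areaFactor ℓ
  set I := inner ℝ ((diagFrame d).pt ((v, t) - (u, profile C u))) (graphNormal ℓ)
  set R := ‖(diagFrame d).pt ((v, t) - (u, profile C u))‖
  have hR : 0 ≤ R := norm_nonneg _
  simp only [Prod.fst_sub, Prod.snd_sub] at h1 h2
  rw [Real.norm_eq_abs] at hy
  have h3 := abs_le.1 (hy.trans (mul_le_mul_of_nonneg_left h2 hε.le))
  have h4 : 0 ≤ ε * R := by positivity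
  constructor
  · intro hI
    have : ε * R < A * I := hI.trans_le (le_mul_of_one_le_left (h4.trans hI.le) hA)
    linarith [h3.2]
  · intro hI
    have : ε * R < A * (-I) := by
      refine lt_of_lt_of_le ?_ (le_mul_of_one_le_left (by linarith) hA)
      linarith
    linarith [h3.1]

theorem ae_differentiableAt_profile : ∀ᵐ u, DifferentiableAt ℝ (profile C) u :=
  hC.lipschitz_profile.ae_differentiableAt

theorem lintegral_frontier (g : Space d → ℝ≥0∞) :
    ∫⁻ x in frontier C, g x ∂μHE[d] =
      ∫⁻ u, ENNReal.ofReal (Frame.areaFactor (fderiv ℝ (profile C) u)) *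
        g ((diagFrame d).graphMap (profile C) u) := by
  rw [hC.frontier_eq_range, Frame.lintegral_range_graphMap _ hC.lipschitz_profile]

theorem functional_frontier (η : Space d → ℝ) : functional η (frontier C) =
    ∫⁻ u, ENNReal.ofReal (Frame.areaFactor (fderiv ℝ (profile C) u)) *
      ENNReal.ofReal (η (graphNormal (fderiv ℝ (profile C) u))) := by
  rw [functional, hC.lintegral_frontier]
  refine lintegral_congr_ae ?_
  filter_upwards [hC.ae_differentiableAt_profile] with u hu
  rw [(hC.isNormalAt_graphMap hu.hasFDerivAt).normal_eq]

theorem isMonotoneSurface_frontier : IsMonotoneSurface (volume (octant d \ C)) (frontier C) where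
  subset_octant := hC.frontier_subset_octant
  manifold := hC.nonempty_chartedSpace
  isConnected_upperPart := by rw [hC.upperPart_frontier]; exact hC.isConnected_interior
  frontier_lowerPart := by rw [hC.lowerPart_frontier, frontier_compl]
  frontier_upperPart := by
    rw [hC.upperPart_frontier, hC.frontier_eq, isOpen_interior.frontier_eq, hC.closure_interior]
  ae_normal := by
    have hG : MeasurableSet (frontier C) := isClosed_frontier.measurableSet
    have hnull : (μHE[d] : Measure (Space d)) ((diagFrame d).graphMap (profile C) ''
        {u | DifferentiableAt ℝ (profile C) u}ᶜ) = 0 :=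
      Frame.area_image_null _ hC.lipschitz_profile hC.ae_differentiableAt_profile
    rw [ae_restrict_iff' hG]
    refine measure_mono_null (fun x hx => ?_) hnull
    simp only [mem_compl_iff, mem_ofPred_eq, Classical.not_imp] at hx
    obtain ⟨hxG, hx⟩ := hx
    obtain ⟨u, rfl⟩ := hC.frontier_eq_range ▸ hxG
    refine ⟨u, fun hu => hx ?_, rfl⟩
    have hn := hC.isNormalAt_graphMap hu.hasFDerivAt
    exact ⟨_, hC.isNormalAt_mem_sphericalOctant (hC.graphMap_mem u) hn, hn⟩
  vol_eq := by rw [vol, hC.body_frontier]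

end IsUpperBody

/-! ### Monotone surfaces bound upper bodies -/

/-- Lines in a given direction that avoid a set without surface area pass arbitrarily close to any
point: the orthogonal projection of such a set onto a hyperplane is a null set. -/
theorem exists_line_avoiding {N : Set (Space d)} (hN : (μHE[d] : Measure (Space d)) N = 0)
    {e : Space d} (he : e ≠ 0) {W : Set (Space d)} (hW : IsOpen W) (hWne : W.Nonempty) :
    ∃ x ∈ W, ∀ t : ℝ, x + t • e ∉ N := by
  obtain ⟨Φ, hΦ⟩ := Frame.exists_axis_eq (‖e‖⁻¹ • e) (by
    rw [norm_smul, norm_inv, norm_norm, inv_mul_cancel₀ (norm_ne_zero_iff.2 he)])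
  have hnull : volume (Φ.proj '' N) = 0 := by
    have := area_image_le d (Φ.lipschitz_proj.lipschitzOnWith (s := N))
    rw [hN, mul_zero, EuclideanSpace.euclideanHausdorffMeasure_eq_volume] at this
    exact le_antisymm this zero_le
  obtain ⟨x, hx⟩ := hWne
  let g : Base d → Space d := fun u => Φ.pt (u, inner ℝ x Φ.axis)
  have hg : Continuous g := Φ.ptL.continuous.comp (Continuous.prodMk_left _)
  have hgx : g (Φ.proj x) ∈ W := by
    change Φ.pt _ ∈ W
    rwa [Φ.pt_proj]
  have hdense : Dense (Φ.proj '' N)ᶜ := Measure.dense_of_ae (μ := volume)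
    (compl_mem_ae_iff.2 hnull)
  obtain ⟨u, hu, huN⟩ := hdense.inter_open_nonempty _ (hW.preimage hg) ⟨_, hgx⟩
  refine ⟨g u, hu, fun t ht => huN ⟨_, ht, ?_⟩⟩
  have : g u + t • e = Φ.pt (u, inner ℝ x Φ.axis + t * ‖e‖) := by
    have h2 : e = ‖e‖ • Φ.axis := by rw [hΦ, smul_inv_smul₀ (norm_ne_zero_iff.2 he)]
    conv_lhs => rw [h2]
    simp only [g, Frame.pt, add_smul, smul_smul]
    abel
  rw [this, Frame.proj_pt]

namespace IsMonotoneSurface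

variable {q : ℝ≥0∞} {G : Set (Space d)} (hG : IsMonotoneSurface q G)
include hG

theorem isClosed : IsClosed G := hG.frontier_lowerPart ▸ isClosed_frontier

theorem isOpen_lowerPart : IsOpen (lowerPart G) :=
  hG.isClosed.isOpen_compl.connectedComponentIn

theorem closure_lowerPart : closure (lowerPart G) = G ∪ lowerPart G := by
  rw [closure_eq_self_union_frontier, hG.frontier_lowerPart, union_comm]

theorem upperPart_eq : upperPart G = (closure (lowerPart G))ᶜ := by
  rw [hG.closure_lowerPart]; rfl

theorem isOpen_upperPart : IsOpen (upperPart G) := by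
  rw [hG.upperPart_eq]; exact isClosed_closure.isOpen_compl

theorem compl_lowerPart : (lowerPart G)ᶜ = closure (upperPart G) := by
  rw [closure_eq_self_union_frontier, hG.frontier_upperPart]
  have hd : lowerPart G ⊆ Gᶜ := connectedComponentIn_subset _ _
  ext x
  have := @hd x
  simp only [upperPart, mem_compl_iff, mem_union] at *
  tauto

/-- A line in a positive direction crosses a monotone surface only from below to above, at least
if it meets the surface only at points with a normal vector in the spherical octant. -/
theorem add_notMem_lowerPart_of_line {x e : Space d} (he : e ∈ posOctant d)
    (hx : x ∈ upperPart G)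
    (hline : ∀ t : ℝ, x + t • e ∈ G → ∃ n ∈ sphericalOctant d, IsNormalAt G (x + t • e) n) :
    x + e ∉ lowerPart G := by
  intro hL
  have hc : Continuous fun t : ℝ => x + t • e := by fun_prop
  set S : Set ℝ := {t | t ∈ Icc (0 : ℝ) 1 ∧ x + t • e ∈ upperPart G} with hS
  have h0 : (0 : ℝ) ∈ S := ⟨⟨le_rfl, zero_le_one⟩, by simpa using hx⟩
  have hbdd : BddAbove S := ⟨1, fun t ht => ht.1.2⟩
  set τ := sSup S with hτ
  have hτ0 : 0 ≤ τ := le_csSup hbdd h0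
  have hτ1 : τ ≤ 1 := csSup_le ⟨0, h0⟩ fun t ht => ht.1.2
  -- no points above the surface come right after `τ`
  have hafter : τ < 1 → ¬ ∀ᶠ t : ℝ in 𝓝[>] 0, x + τ • e + t • e ∈ upperPart G := by
    intro hlt h
    have h1 : ∀ᶠ t : ℝ in 𝓝[>] 0, t < 1 - τ :=
      (eventually_lt_nhds (sub_pos.2 hlt)).filter_mono nhdsWithin_le_nhds
    obtain ⟨t, ht, ht1, ht0⟩ := (h.and (h1.and self_mem_nhdsWithin)).exists
    have ht0 : 0 < t := ht0
    rw [add_assoc, ← add_smul] at ht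
    have : τ + t ≤ τ := le_csSup hbdd ⟨⟨by linarith, by linarith⟩, ht⟩
    linarith
  have hlt : x + τ • e ∉ lowerPart G → τ < 1 := fun h => by
    refine lt_of_le_of_ne hτ1 fun h1 => h ?_
    rwa [h1, one_smul]
  by_cases hl : x + τ • e ∈ lowerPart G
  · obtain ⟨ε, hε, hball⟩ := Metric.isOpen_iff.1 (hG.isOpen_lowerPart.preimage hc) τ hl
    obtain ⟨t, ht, htτ⟩ := exists_lt_of_lt_csSup ⟨0, h0⟩ (show τ - ε < sSup S by linarith)
    have htle : t ≤ τ := le_csSup hbdd ht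
    have : x + t • e ∈ lowerPart G := hball (by
      rw [Metric.mem_ball, Real.dist_eq, abs_lt]; constructor <;> linarith)
    exact ht.2 (Or.inr this)
  · refine hafter (hlt hl) ?_
    by_cases hu : x + τ • e ∈ upperPart G
    · have hc' : Continuous fun t : ℝ => x + τ • e + t • e := by fun_prop
      exact (hc'.continuousAt.eventually (hG.isOpen_upperPart.mem_nhds (by simpa using hu))
        ).filter_mono nhdsWithin_le_nhds
    · have hmem : x + τ • e ∈ G := by
        by_contra hg
        exact hu fun h => h.elim hg hl
      obtain ⟨n, hnΔ, hn⟩ := hline τ hmem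
      refine hn.eventually_mem_upperPart (inner_pos_of_mem_posOctant he hnΔ.2 ?_)
      rintro rfl
      simpa using hn.1

theorem isUpperBody_compl_lowerPart : IsUpperBody (lowerPart G)ᶜ where
  isClosed := hG.isOpen_lowerPart.isClosed_compl
  nonempty := by
    rw [hG.compl_lowerPart]; exact hG.isConnected_upperPart.nonempty.closure
  subset_octant := by
    rw [compl_subset_comm]
    exact isPreconnected_compl_octant.subset_connectedComponentIn outerPoint_notMem_octant
      (compl_subset_compl.2 hG.subset_octant)
  add_mem := by
    intro x hx y hy hL
    -- perturb both points so as to get a generic line in a positive direction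
    have hc : Continuous fun t : ℝ => x + (y + t • ones d) := by fun_prop
    have h1 : ∀ᶠ t : ℝ in 𝓝[>] 0, x + (y + t • ones d) ∈ lowerPart G :=
      (hc.continuousAt.eventually (hG.isOpen_lowerPart.mem_nhds (by simpa using hL))
        ).filter_mono nhdsWithin_le_nhds
    obtain ⟨t, ht, ht0⟩ := (h1.and self_mem_nhdsWithin).exists
    set e := y + t • ones d with he
    have hepos : e ∈ posOctant d := fun i => by
      have h2 := hy i
      have h3 : 0 < t := ht0
      simp only [he, PiLp.add_apply, PiLp.smul_apply, ones_apply, smul_eq_mul, mul_one]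
      linarith
    have hW : IsOpen (upperPart G ∩ (fun z => z + e) ⁻¹' lowerPart G) :=
      hG.isOpen_upperPart.inter (hG.isOpen_lowerPart.preimage (by fun_prop))
    have hWne : (upperPart G ∩ (fun z => z + e) ⁻¹' lowerPart G).Nonempty := by
      rw [hG.compl_lowerPart] at hx
      rw [inter_comm]
      exact mem_closure_iff.1 hx _ (hG.isOpen_lowerPart.preimage (by fun_prop)) ht
    have hN := hG.ae_normal
    rw [ae_restrict_iff' hG.isClosed.measurableSet, ae_iff] at hN
    have hene : e ≠ 0 := fun h => by have := hepos 0; simp [h] at this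
    obtain ⟨z, ⟨hzU, hzL⟩, hz⟩ := exists_line_avoiding hN hene hW hWne
    refine hG.add_notMem_lowerPart_of_line hepos hzU (fun s hs => ?_) hzL
    have := hz s
    simp only [mem_ofPred_eq, not_not] at this
    exact this hs

theorem exists_isUpperBody : ∃ C, IsUpperBody C ∧ G = frontier C ∧ volume (octant d \ C) = q := by
  refine ⟨_, hG.isUpperBody_compl_lowerPart, ?_, ?_⟩
  · rw [frontier_compl, hG.frontier_lowerPart]
  · rw [← hG.vol_eq, vol, body, sdiff_eq, compl_compl]

end IsMonotoneSurface

/-! ### Radial functions -/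

open Classical in
/-- The radial function of an upper body: in a direction of the open octant, the distance (in
multiples of the direction vector) at which the body is entered; it is `0` in other directions. -/
def radial (C : Set (Space d)) (x : Space d) : ℝ :=
  if x ∈ posOctant d then sInf {t | 0 ≤ t ∧ t • x ∈ C} else 0

theorem radial_of_notMem (C : Set (Space d)) {x : Space d} (hx : x ∉ posOctant d) :
    radial C x = 0 := if_neg hx

theorem smul_mem_posOctant_iff {c : ℝ} (hc : 0 < c) {x : Space d} :
    c • x ∈ posOctant d ↔ x ∈ posOctant d := by
  refine ⟨fun h => ?_, smul_mem_posOctant hc⟩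
  have := smul_mem_posOctant (inv_pos.2 hc) h
  rwa [inv_smul_smul₀ hc.ne'] at this

theorem radial_smul_vector (C : Set (Space d)) {c : ℝ} (hc : 0 < c) (x : Space d) :
    radial C (c • x) = c⁻¹ * radial C x := by
  by_cases hx : x ∈ posOctant d
  · rw [radial, if_pos (smul_mem_posOctant hc hx), radial, if_pos hx, ← smul_eq_mul c⁻¹,
      ← Real.sInf_smul_of_nonneg (inv_pos.2 hc).le]
    congr 1
    ext t
    simp only [mem_ofPred_eq, mem_smul_set]
    constructor
    · rintro ⟨h1, h2⟩
      refine ⟨c * t, ⟨by positivity, by rwa [mul_comm, mul_smul]⟩, ?_⟩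
      rw [smul_eq_mul, inv_mul_cancel_left₀ hc.ne']
    · rintro ⟨s, ⟨h1, h2⟩, rfl⟩
      refine ⟨by rw [smul_eq_mul]; positivity, ?_⟩
      rwa [smul_eq_mul, smul_smul, mul_assoc, mul_comm s, inv_mul_cancel_left₀ hc.ne']
  · rw [radial_of_notMem _ hx, radial_of_notMem, mul_zero]
    rwa [smul_mem_posOctant_iff hc]

theorem radial_nonneg (C : Set (Space d)) (x : Space d) : 0 ≤ radial C x := by
  rw [radial]
  split_ifs
  · exact Real.sInf_nonneg fun t ht => ht.1
  · exact le_rfl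

namespace IsUpperBody

variable {C : Set (Space d)} (hC : IsUpperBody C)
include hC

theorem smul_mem_iff {x : Space d} (hx : x ∈ posOctant d) {t : ℝ} (ht : 0 ≤ t) :
    t • x ∈ C ↔ radial C x ≤ t := by
  have hclosed : IsClosed {t : ℝ | 0 ≤ t ∧ t • x ∈ C} :=
    isClosed_Ici.inter (hC.isClosed.preimage (by fun_prop))
  have hbdd : BddBelow {t : ℝ | 0 ≤ t ∧ t • x ∈ C} := ⟨0, fun t ht => ht.1⟩
  have hne : {t : ℝ | 0 ≤ t ∧ t • x ∈ C}.Nonempty := by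
    obtain ⟨y, hy⟩ := hC.nonempty
    have hfin : (range fun i => y i / x i).Finite := finite_range _
    obtain ⟨M, hM⟩ := hfin.bddAbove
    refine ⟨max M 0, le_max_right _ _, hC.mem_of_forall_le hy fun i => ?_⟩
    have := (hM (mem_range_self i)).trans (le_max_left M 0)
    rwa [div_le_iff₀ (hx i)] at this
  rw [radial, if_pos hx]
  refine ⟨fun h => csInf_le hbdd ⟨ht, h⟩, fun h => ?_⟩
  refine hC.mem_of_forall_le (hclosed.csInf_mem hne hbdd).2 fun i => ?_
  exact mul_le_mul_of_nonneg_right h (hx i).le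

theorem radial_smul_mem {x : Space d} (hx : x ∈ posOctant d) : radial C x • x ∈ C :=
  (hC.smul_mem_iff hx (radial_nonneg C x)).2 le_rfl

theorem mem_iff_radial_le {x : Space d} (hx : x ∈ posOctant d) : x ∈ C ↔ radial C x ≤ 1 := by
  rw [← hC.smul_mem_iff hx zero_le_one, one_smul]

theorem smul_mem_interior_of_lt {x : Space d} (hx : x ∈ posOctant d) {t : ℝ}
    (ht : radial C x < t) : t • x ∈ interior C := by
  have := hC.add_mem_interior (hC.radial_smul_mem hx) (smul_mem_posOctant (sub_pos.2 ht) hx)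
  rwa [← add_smul, add_sub_cancel] at this

theorem radial_lt_of_mem_interior {x : Space d} (hx : x ∈ interior C) : radial C x < 1 := by
  have hc : Continuous fun t : ℝ => (1 - t) • x := by fun_prop
  have h1 : ∀ᶠ t : ℝ in 𝓝[>] 0, (1 - t) • x ∈ interior C :=
    (hc.continuousAt.eventually (isOpen_interior.mem_nhds (by simpa using hx))
      ).filter_mono nhdsWithin_le_nhds
  have h2 : ∀ᶠ t : ℝ in 𝓝[>] 0, t < 1 :=
    (eventually_lt_nhds zero_lt_one).filter_mono nhdsWithin_le_nhds
  obtain ⟨t, ht, ht1, ht0⟩ := (h1.and (h2.and self_mem_nhdsWithin)).exists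
  have ht0 : 0 < t := ht0
  have := (hC.smul_mem_iff (hC.interior_subset_posOctant hx) (by linarith)).1 (interior_subset ht)
  linarith

theorem mem_frontier_iff {x : Space d} (hx : x ∈ posOctant d) :
    x ∈ frontier C ↔ radial C x = 1 := by
  rw [hC.frontier_eq, mem_sdiff, hC.mem_iff_radial_le hx]
  refine ⟨fun h => le_antisymm h.1 (not_lt.1 fun hlt => h.2 ?_), fun h => ⟨h.le, fun hi => ?_⟩⟩
  · simpa using hC.smul_mem_interior_of_lt hx hlt
  · exact (hC.radial_lt_of_mem_interior hi).ne h

theorem measurable_radial : Measurable (radial C) := by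
  refine measurable_of_Iic fun c => ?_
  rcases lt_or_ge c 0 with hc | hc
  · convert! MeasurableSet.empty
    ext x
    simpa using hc.trans_le (radial_nonneg C x)
  · have : radial C ⁻¹' Iic c = (posOctant d)ᶜ ∪ {x | c • x ∈ C} := by
      ext x
      by_cases hx : x ∈ posOctant d
      · simp [hx, hC.smul_mem_iff hx hc]
      · simp [hx, radial_of_notMem _ hx, hc]
    rw [this]
    exact isOpen_posOctant.measurableSet.compl.union
      (hC.isClosed.preimage (by fun_prop)).measurableSet

end IsUpperBody

/-! ### Integration in polar coordinates -/

/-- Integration over the region below an upper body in polar coordinates. -/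
theorem IsUpperBody.lintegral_posOctant_diff {C : Set (Space d)} (hC : IsUpperBody C)
    {φ : Space d → ℝ≥0∞} (hφ : Measurable φ) (hhom : ∀ (t : ℝ) x, 0 < t → φ (t • x) = φ x) :
    (d + 1 : ℝ≥0∞) * ∫⁻ x in posOctant d \ C, φ x =
      ∫⁻ θ, ENNReal.ofReal (radial C (θ : Space d) ^ (d + 1)) * φ θ
        ∂(volume : Measure (Space d)).toSphere := by
  have hfin : Module.finrank ℝ (Space d) = d + 1 := by simp
  have hQ : MeasurableSet (posOctant d \ C) :=
    isOpen_posOctant.measurableSet.diff hC.isClosed.measurableSet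
  have hmp := (volume : Measure (Space d)).measurePreserving_homeomorphUnitSphereProd
  set h : Space d → ℝ≥0∞ := (posOctant d \ C).indicator φ with hh
  have hmeas : Measurable h := hφ.indicator hQ
  have hval : ∀ p : Metric.sphere (0 : Space d) 1 × Ioi (0 : ℝ), h ((p.2 : ℝ) • (p.1 : Space d)) =
      φ p.1 * (Iio (radial C p.1)).indicator 1 (p.2 : ℝ) := by
    rintro ⟨θ, r⟩
    have hr : 0 < (r : ℝ) := r.2
    by_cases hθ : (θ : Space d) ∈ posOctant d
    · by_cases hrad : (r : ℝ) < radial C θ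
      · have : (r : ℝ) • (θ : Space d) ∈ posOctant d \ C :=
          ⟨smul_mem_posOctant hr hθ, by rw [hC.smul_mem_iff hθ hr.le, not_le]; exact hrad⟩
        simp [hh, this, hrad, hhom _ _ hr]
      · have : (r : ℝ) • (θ : Space d) ∉ posOctant d \ C := fun hm => hm.2 (by
          rw [hC.smul_mem_iff hθ hr.le]; exact not_lt.1 hrad)
        simp [hh, this, hrad]
    · have : (r : ℝ) • (θ : Space d) ∉ posOctant d \ C := fun hm =>
        hθ ((smul_mem_posOctant_iff hr).1 hm.1)
      have h2 : ¬ (r : ℝ) < radial C θ := by rw [radial_of_notMem _ hθ]; exact not_lt.2 hr.le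
      simp [hh, this, h2]
  have h1 : ∫⁻ x in posOctant d \ C, φ x =
      ∫⁻ p : Metric.sphere (0 : Space d) 1 × Ioi (0 : ℝ), h ((p.2 : ℝ) • (p.1 : Space d))
        ∂((volume : Measure (Space d)).toSphere.prod
          (Measure.volumeIoiPow (Module.finrank ℝ (Space d) - 1))) := by
    rw [← lintegral_indicator hQ, ← hmp.lintegral_comp (by fun_prop)]
    have h3 : ∀ x : ({0}ᶜ : Set (Space d)),
        h (((homeomorphUnitSphereProd (Space d) x).2 : ℝ) •
          ((homeomorphUnitSphereProd (Space d) x).1 : Space d)) = h x := by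
      intro x
      congr 1
      have hx : ‖(x : Space d)‖ ≠ 0 := norm_ne_zero_iff.2 x.2
      simp [smul_smul, hx]
    simp only [h3]
    rw [lintegral_subtype_comap (measurableSet_singleton (0 : Space d)).compl, ← hh]
    refine (setLIntegral_univ h).symm.trans (setLIntegral_congr ?_)
    refine ae_eq_set.2 ⟨?_, ?_⟩ <;> simp
  have hvol : ∀ θ : Metric.sphere (0 : Space d) 1,
      (Measure.volumeIoiPow d) {r : Ioi (0 : ℝ) | (r : ℝ) < radial C θ} =
        ENNReal.ofReal (radial C (θ : Space d) ^ (d + 1) / (d + 1)) := by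
    intro θ
    rcases (radial_nonneg C θ).eq_or_lt with h0 | h0
    · have : {r : Ioi (0 : ℝ) | (r : ℝ) < radial C θ} = ∅ := by
        ext r
        simpa [← h0] using (show (0 : ℝ) < r from r.2).le
      rw [this, measure_empty, ← h0]
      simp
    · exact Measure.volumeIoiPow_apply_Iio d ⟨radial C θ, h0⟩
  rw [h1, hfin, Nat.add_sub_cancel]
  rw [lintegral_prod _ (by fun_prop), ← lintegral_const_mul' _ _ (by finiteness)]
  refine lintegral_congr fun θ => ?_
  have hm : MeasurableSet {r : Ioi (0 : ℝ) | (r : ℝ) < radial C θ} :=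
    measurableSet_lt measurable_subtype_coe measurable_const
  have h4 : (fun r : Ioi (0 : ℝ) => h ((r : ℝ) • (θ : Space d))) =
      fun r => φ θ * ({r : Ioi (0 : ℝ) | (r : ℝ) < radial C θ}.indicator 1 r) :=
    funext fun r => hval (θ, r)
  change (d + 1 : ℝ≥0∞) * ∫⁻ r : Ioi (0 : ℝ), h ((r : ℝ) • (θ : Space d)) ∂_ = _
  rw [h4, lintegral_const_mul _ (measurable_one.indicator hm), lintegral_indicator_one hm, hvol,
    mul_left_comm, mul_comm]
  congr 1
  have : (d + 1 : ℝ≥0∞) = ENNReal.ofReal (d + 1) := by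
    rw [ENNReal.ofReal_add (by positivity) zero_le_one]; simp
  rw [this, ← ENNReal.ofReal_mul (by positivity)]
  congr 1
  field_simp

/-! ### The cone formula -/

/-- The derivative at `(u, t)` of the map `(u, t) ↦ (t • u, t * f u)`, where `a` and `ℓ` are the
value and the derivative of `f` at `u`. -/
def coneDeriv (u : Base d) (t a : ℝ) (ℓ : Base d →L[ℝ] ℝ) :
    (Base d × ℝ) →L[ℝ] (Base d × ℝ) :=
  (t • ContinuousLinearMap.fst ℝ (Base d) ℝ +
      (ContinuousLinearMap.snd ℝ (Base d) ℝ).smulRight u).prod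
    (t • ℓ.comp (ContinuousLinearMap.fst ℝ (Base d) ℝ) +
      a • ContinuousLinearMap.snd ℝ (Base d) ℝ)

theorem hasFDerivAt_cone {f : Base d → ℝ} {u : Base d} {ℓ : Base d →L[ℝ] ℝ}
    (h : HasFDerivAt f ℓ u) (t : ℝ) :
    HasFDerivAt (fun p : Base d × ℝ => (p.2 • p.1, p.2 * f p.1)) (coneDeriv u t (f u) ℓ)
      (u, t) := by
  have h1 : HasFDerivAt (fun p : Base d × ℝ => p.2 • p.1)
      (t • ContinuousLinearMap.fst ℝ (Base d) ℝ +
        (ContinuousLinearMap.snd ℝ (Base d) ℝ).smulRight u) (u, t) :=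
    (hasFDerivAt_snd (𝕜 := ℝ) (p := (u, t))).smul (hasFDerivAt_fst (𝕜 := ℝ) (p := (u, t)))
  have h2 : HasFDerivAt (fun p : Base d × ℝ => f p.1)
      (ℓ.comp (ContinuousLinearMap.fst ℝ (Base d) ℝ)) (u, t) :=
    HasFDerivAt.comp (u, t) h hasFDerivAt_fst
  exact h1.prodMk ((hasFDerivAt_snd (𝕜 := ℝ) (p := (u, t))).mul h2)

/-- The derivative of the cone map is a product of two transvections and a dilation. -/
theorem det_coneDeriv (u : Base d) (t a : ℝ) (ℓ : Base d →L[ℝ] ℝ) :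
    (coneDeriv u t a ℓ).det = t ^ d * (a - ℓ u) := by
  let D : (Base d × ℝ) →ₗ[ℝ] (Base d × ℝ) :=
    LinearMap.prodMap (t • LinearMap.id) LinearMap.id
  let Y : (Base d × ℝ) →ₗ[ℝ] (Base d × ℝ) :=
    LinearMap.transvection (LinearMap.snd ℝ (Base d) ℝ) (u, 0)
  let X : (Base d × ℝ) →ₗ[ℝ] (Base d × ℝ) :=
    LinearMap.transvection (ℓ.toLinearMap ∘ₗ LinearMap.fst ℝ (Base d) ℝ +
      (a - ℓ u - 1) • LinearMap.snd ℝ (Base d) ℝ) (0, 1)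
  have key : (coneDeriv u t a ℓ).toLinearMap = X ∘ₗ Y ∘ₗ D := by
    apply LinearMap.ext
    rintro ⟨v, s⟩
    simp only [coneDeriv, X, Y, D, LinearMap.comp_apply, LinearMap.transvection.apply]
    ext1
    · simp
    · simp
      ring
  have hX : LinearMap.det X = a - ℓ u := by
    rw [LinearMap.transvection.det]; simp
  have hY : LinearMap.det Y = 1 := by
    rw [LinearMap.transvection.det]; simp
  have hD : LinearMap.det D = t ^ d := by
    rw [LinearMap.det_prodMap, LinearMap.det_smul]; simp
  rw [ContinuousLinearMap.det, key, LinearMap.det_comp, LinearMap.det_comp, hX, hY, hD]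
  ring

/-- The cone over a null set of a Lipschitz graph is a null set. -/
theorem Frame.volume_cone_null (Φ : Frame d) {f : Base d → ℝ} {K : NNReal} (hf : LipschitzWith K f)
    {N : Set (Base d)} (hN : volume N = 0) :
    volume {x | ∃ u ∈ N, ∃ t ∈ Ioo (0 : ℝ) 1, x = t • Φ.graphMap f u} = 0 := by
  let g : Space d → Space d := fun x => (inner ℝ x Φ.axis : ℝ) • Φ.graphMap f (Φ.proj x)
  let M : ℕ → Set (Space d) := fun R => Φ.pt '' ((N ∩ Metric.closedBall 0 R) ×ˢ Ioo (0 : ℝ) 1)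
  have hM : ∀ R, volume (M R) = 0 := by
    intro R
    have h0 : volume ((N ∩ Metric.closedBall (0 : Base d) R) ×ˢ Ioo (0 : ℝ) 1) = 0 := by
      rw [Measure.volume_eq_prod, Measure.prod_prod, measure_mono_null inter_subset_left hN,
        zero_mul]
    have h1 := Φ.measurePreserving_ptL.measure_preimage_emb
      Φ.ptL.toHomeomorph.measurableEmbedding (M R)
    rw [← h1]
    convert! h0
    exact preimage_image_eq _ Φ.ptL.injective
  have hL : ∀ R, ∃ K', LipschitzOnWith K' g (M R) := by
    intro R
    refine ⟨(‖Φ.graphMap f 0‖₊ + (1 + K) * R) + (1 + K), LipschitzOnWith.of_dist_le_mul ?_⟩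
    rintro _ ⟨⟨u, s⟩, ⟨⟨-, hu⟩, hs⟩, rfl⟩ _ ⟨⟨v, t⟩, ⟨-, ht⟩, rfl⟩
    simp only [g, Frame.inner_pt_axis, Frame.proj_pt]
    have h1 := (Φ.lipschitz_graphMap hf).dist_le_mul u v
    have h2 := (Φ.lipschitz_graphMap hf).dist_le_mul u 0
    rw [dist_eq_norm] at h1 h2
    have h3 : ‖Φ.graphMap f u‖ ≤ ‖Φ.graphMap f 0‖ + (1 + K) * R := by
      have h4 := norm_le_norm_add_norm_sub' (Φ.graphMap f u) (Φ.graphMap f 0)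
      have h5 : ((1 + K : NNReal) : ℝ) * dist u 0 ≤ (1 + K) * R := by
        push_cast
        exact mul_le_mul_of_nonneg_left hu (by positivity)
      linarith
    have h6 := Φ.norm_fst_le ((u, s) - (v, t))
    have h7 := Φ.abs_snd_le ((u, s) - (v, t))
    rw [← Frame.pt_sub, ← dist_eq_norm] at h6 h7
    simp only [Prod.fst_sub, Prod.snd_sub] at h6 h7
    rw [← dist_eq_norm] at h6
    have h8 : s • Φ.graphMap f u - t • Φ.graphMap f v =
        (s - t) • Φ.graphMap f u + t • (Φ.graphMap f u - Φ.graphMap f v) := by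
      rw [sub_smul, smul_sub]; abel
    rw [dist_eq_norm (s • _), h8]
    refine (norm_add_le _ _).trans ?_
    rw [norm_smul, norm_smul, Real.norm_eq_abs, Real.norm_of_nonneg ht.1.le, NNReal.coe_add,
      add_mul]
    refine add_le_add ?_ ?_
    · rw [mul_comm]
      push_cast
      exact mul_le_mul h3 h7 (abs_nonneg _) (by positivity)
    · calc t * ‖Φ.graphMap f u - Φ.graphMap f v‖ ≤ 1 * ‖Φ.graphMap f u - Φ.graphMap f v‖ :=
            mul_le_mul_of_nonneg_right ht.2.le (norm_nonneg _)
        _ ≤ ((1 + K : NNReal) : ℝ) * dist u v := by rw [one_mul]; exact h1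
        _ ≤ _ := mul_le_mul_of_nonneg_left h6 (NNReal.coe_nonneg _)
  have hnull : ∀ R, volume (g '' M R) = 0 := by
    intro R
    obtain ⟨K', hK'⟩ := hL R
    have h1 := area_image_le (d + 1) hK'
    have h2 : (μHE[d + 1] : Measure (Space d)) = volume :=
      EuclideanSpace.euclideanHausdorffMeasure_eq_volume (d + 1)
    rw [h2, hM, mul_zero] at h1
    exact le_antisymm h1 zero_le
  refine measure_mono_null ?_ (measure_iUnion_null hnull)
  rintro x ⟨u, hu, t, ht, rfl⟩
  obtain ⟨R, hR⟩ := exists_nat_ge ‖u‖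
  refine mem_iUnion.2 ⟨R, _, ⟨(u, t), ⟨⟨hu, by simpa using hR⟩, ht⟩, rfl⟩, ?_⟩
  simp [g]

/-- The cone formula: the volume below an upper body is swept by the segments joining the origin to
the boundary, an element of surface area contributing the volume of a cone. -/
theorem IsUpperBody.lintegral_cone {C : Set (Space d)} (hC : IsUpperBody C)
    {φ : Space d → ℝ≥0∞} (hφ : Measurable φ) (hhom : ∀ (t : ℝ) x, 0 < t → φ (t • x) = φ x) :
    ∫⁻ u in {u | (diagFrame d).graphMap (profile C) u ∈ posOctant d},
        ENNReal.ofReal (profile C u - fderiv ℝ (profile C) u u) *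
          φ ((diagFrame d).graphMap (profile C) u) =
      (d + 1 : ℝ≥0∞) * ∫⁻ x in posOctant d \ C, φ x := by
  set Φ := diagFrame d
  set f := profile C with hfdef
  have hfL := hC.lipschitz_profile
  have hfm : Measurable f := hfL.continuous.measurable
  have hF : Continuous (Φ.graphMap f) := Φ.continuous_graphMap hfL.continuous
  have hdf : Measurable (fderiv ℝ f) := measurable_fderiv ℝ f
  have hU : MeasurableSet {u | Φ.graphMap f u ∈ posOctant d} :=
    (isOpen_posOctant.preimage hF).measurableSet
  have hD : MeasurableSet {u | DifferentiableAt ℝ f u} := measurableSet_of_differentiableAt ℝ f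
  set U : Set (Base d) := {u | Φ.graphMap f u ∈ posOctant d} ∩ {u | DifferentiableAt ℝ f u} with hUd
  have hUm : MeasurableSet U := hU.inter hD
  set S : Set (Base d × ℝ) := U ×ˢ Ioo (0 : ℝ) 1 with hS
  have hSm : MeasurableSet S := hUm.prod measurableSet_Ioo
  let Ψ : Base d × ℝ → Base d × ℝ := fun p => (p.2 • p.1, p.2 * f p.1)
  have hΨ : ∀ p, Φ.pt (Ψ p) = p.2 • Φ.graphMap f p.1 := fun p => by
    rw [Frame.graphMap, Frame.smul_pt]; rfl
  have hrad : ∀ p ∈ S, radial C (Φ.pt (Ψ p)) = p.2⁻¹ := fun p hp => by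
    rw [hΨ, radial_smul_vector _ hp.2.1,
      (hC.mem_frontier_iff hp.1.1).1 (hC.graphMap_mem_frontier _), mul_one]
  have hinj : InjOn Ψ S := by
    intro p hp p' hp' h
    have h1 : p.2 = p'.2 := by
      have := hrad p hp
      rw [h, hrad p' hp'] at this
      exact inv_injective this.symm
    have h2 : p.2 • p.1 = p'.2 • p'.1 := congrArg Prod.fst h
    rw [← h1] at h2
    exact Prod.ext (smul_right_injective _ hp.2.1.ne' h2) h1
  have hderiv : ∀ p ∈ S, HasFDerivWithinAt Ψ (coneDeriv p.1 p.2 (f p.1) (fderiv ℝ f p.1)) S p :=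
    fun p hp => (hasFDerivAt_cone (DifferentiableAt.hasFDerivAt hp.1.2) p.2).hasFDerivWithinAt
  have hnonneg : ∀ u ∈ U, 0 ≤ f u - fderiv ℝ f u u := by
    intro u hu
    have h1 := areaFactor_mul_inner_graphNormal (fderiv ℝ f u) (u, f u)
    have h2 := hC.inner_nonneg_of_isNormalAt (hC.graphMap_mem u)
      (hC.isNormalAt_graphMap (DifferentiableAt.hasFDerivAt hu.2))
      (hC.subset_octant (hC.graphMap_mem u))
    rw [← h1]
    exact mul_nonneg (areaFactor_pos _).le h2
  -- the cone over the points with a normal vector fills the region below the body up to a null set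
  have hcone : ∫⁻ x in posOctant d \ C, φ x = ∫⁻ p in Ψ '' S, φ (Φ.pt p) := by
    have h1 := Φ.measurePreserving_ptL.setLIntegral_comp_emb
      Φ.ptL.toHomeomorph.measurableEmbedding φ (Ψ '' S)
    refine Eq.trans ?_ h1.symm
    refine setLIntegral_congr (ae_eq_set.2 ⟨?_, ?_⟩)
    · have hnull : volume {u | DifferentiableAt ℝ f u}ᶜ = 0 := hC.ae_differentiableAt_profile
      refine measure_mono_null ?_ (Φ.volume_cone_null hfL hnull)
      rintro x ⟨⟨hx, hxC⟩, hxS⟩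
      rw [hC.mem_iff_radial_le hx, not_le] at hxC
      have hr : 0 < radial C x := zero_lt_one.trans hxC
      have hfr : radial C x • x ∈ frontier C := by
        rw [hC.mem_frontier_iff (smul_mem_posOctant hr hx), radial_smul_vector _ hr,
          inv_mul_cancel₀ hr.ne']
      rw [hC.frontier_eq_range] at hfr
      obtain ⟨u, hu⟩ := hfr
      have hxu : x = (radial C x)⁻¹ • Φ.graphMap f u := by
        rw [hu, inv_smul_smul₀ hr.ne']
      have ht : (radial C x)⁻¹ ∈ Ioo (0 : ℝ) 1 := ⟨inv_pos.2 hr, inv_lt_one_of_one_lt₀ hxC⟩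
      refine ⟨u, fun hdu => hxS ?_, _, ht, hxu⟩
      refine ⟨Ψ (u, (radial C x)⁻¹), ⟨_, ⟨⟨?_, hdu⟩, ht⟩, rfl⟩, ?_⟩
      · change Φ.graphMap f u ∈ posOctant d
        rw [hu]; exact smul_mem_posOctant hr hx
      · rw [Frame.ptL_apply, hΨ]; exact hxu.symm
    · convert! measure_empty (μ := volume)
      rw [sdiff_eq_empty]
      rintro _ ⟨_, ⟨p, hp, rfl⟩, rfl⟩
      rw [Frame.ptL_apply]
      have hpos : Φ.pt (Ψ p) ∈ posOctant d := by
        rw [hΨ]; exact smul_mem_posOctant hp.2.1 hp.1.1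
      refine ⟨hpos, ?_⟩
      rw [hC.mem_iff_radial_le hpos, hrad p hp, not_le]
      exact one_lt_inv_iff₀.2 hp.2
  have hint : ∫⁻ t in Ioo (0 : ℝ) 1, ENNReal.ofReal (t ^ d) = ENNReal.ofReal (1 / (d + 1)) := by
    rw [Measure.restrict_congr_set Ioo_ae_eq_Ioc,
      ← ofReal_integral_eq_lintegral_ofReal (intervalIntegral.intervalIntegrable_pow _).1,
      ← intervalIntegral.integral_of_le zero_le_one]
    · simp
    · filter_upwards [ae_restrict_mem measurableSet_Ioc] with y hy
      exact pow_nonneg hy.1.le _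
  have hg : Measurable fun u => ENNReal.ofReal (f u - fderiv ℝ f u u) * φ (Φ.graphMap f u) := by
    have h1 : Measurable fun u => fderiv ℝ f u u :=
      isBoundedBilinearMap_apply.continuous.measurable.comp (hdf.prodMk measurable_id)
    exact (hfm.sub h1).ennreal_ofReal.mul (hφ.comp hF.measurable)
  have hmain : ∫⁻ x in posOctant d \ C, φ x =
      (∫⁻ u in U, ENNReal.ofReal (f u - fderiv ℝ f u u) * φ (Φ.graphMap f u)) *
        ENNReal.ofReal (1 / (d + 1)) := by
    rw [hcone, Measure.volume_eq_prod, lintegral_image_eq_lintegral_abs_det_fderiv_mul _ hSm hderiv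
      hinj, ← hint, ← lintegral_prod_mul hg.aemeasurable (by fun_prop), Measure.prod_restrict]
    refine setLIntegral_congr_fun hSm fun p hp => ?_
    rw [det_coneDeriv, hΨ, hhom _ _ hp.2.1, abs_of_nonneg
      (mul_nonneg (pow_nonneg hp.2.1.le _) (hnonneg _ hp.1)),
      ENNReal.ofReal_mul (pow_nonneg hp.2.1.le _)]
    ring
  have hone : ENNReal.ofReal (1 / (d + 1)) * (d + 1 : ℝ≥0∞) = 1 := by
    have : (d + 1 : ℝ≥0∞) = ENNReal.ofReal (d + 1) := by
      rw [ENNReal.ofReal_add (by positivity) zero_le_one]; simp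
    rw [this, ← ENNReal.ofReal_mul (by positivity), one_div,
      inv_mul_cancel₀ (by positivity), ENNReal.ofReal_one]
  rw [hmain, mul_comm, mul_assoc, hone, mul_one]
  refine setLIntegral_congr (ae_eq_set.2 ⟨?_, ?_⟩)
  · exact measure_mono_null (fun u hu hd => hu.2 ⟨hu.1, hd⟩) hC.ae_differentiableAt_profile
  · convert! measure_empty (μ := volume)
    rw [sdiff_eq_empty]
    exact inter_subset_left

/-! ### Volumes and scaling of upper bodies -/

theorem ofReal_natCast_add_one (d : ℕ) : ENNReal.ofReal ((d : ℝ) + 1) = (d + 1 : ℝ≥0∞) := by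
  rw [ENNReal.ofReal_add (by positivity) zero_le_one]; simp

theorem volume_octant_diff_posOctant : volume (octant d \ posOctant d) = 0 := by
  have h : ∀ i : Fin (d + 1), volume {x : Space d | x i = 0} = 0 := by
    intro i
    let s : Submodule ℝ (Space d) := LinearMap.ker (EuclideanSpace.proj (𝕜 := ℝ) i).toLinearMap
    have hs : s ≠ ⊤ := by
      intro h
      have : ones d ∈ s := h ▸ Submodule.mem_top
      simp [s] at this
    have := Measure.addHaar_submodule (volume : Measure (Space d)) s hs
    convert! this
  refine measure_mono_null (fun x hx => ?_) (measure_iUnion_null h)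
  have h1 := hx.2
  simp only [posOctant, mem_ofPred_eq, not_forall, not_lt] at h1
  obtain ⟨i, hi⟩ := h1
  exact mem_iUnion.2 ⟨i, le_antisymm hi (hx.1 i)⟩

theorem volume_octant_diff (C : Set (Space d)) : volume (octant d \ C) = volume (posOctant d \ C) := by
  refine measure_congr (ae_eq_set.2 ⟨measure_mono_null ?_ volume_octant_diff_posOctant, ?_⟩)
  · rintro x ⟨⟨h1, h2⟩, h3⟩
    exact ⟨h1, fun h => h3 ⟨h, h2⟩⟩
  · rw [sdiff_eq_empty.2 (sdiff_le_sdiff_right posOctant_subset_octant), measure_empty]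

theorem radial_smul_set {C : Set (Space d)} {c : ℝ} (hc : 0 < c) (x : Space d) :
    radial (c • C) x = c * radial C x := by
  have h : radial (c • C) x = radial C (c⁻¹ • x) := by
    by_cases hx : x ∈ posOctant d
    · rw [radial, if_pos hx, radial, if_pos (smul_mem_posOctant (inv_pos.2 hc) hx)]
      congr 1
      ext t
      simp only [mem_ofPred_eq, mem_smul_set_iff_inv_smul_mem₀ hc.ne', smul_comm c⁻¹ t x]
    · rw [radial_of_notMem _ hx, radial_of_notMem]
      rwa [smul_mem_posOctant_iff (inv_pos.2 hc)]
  rw [h, radial_smul_vector _ (inv_pos.2 hc), inv_inv]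

namespace IsUpperBody

variable {C : Set (Space d)} (hC : IsUpperBody C)
include hC

/-- The volume below an upper body in polar coordinates. -/
theorem volume_eq_lintegral_radial : (d + 1 : ℝ≥0∞) * volume (octant d \ C) =
    ∫⁻ θ, ENNReal.ofReal (radial C (θ : Space d) ^ (d + 1))
      ∂(volume : Measure (Space d)).toSphere := by
  have := hC.lintegral_posOctant_diff (φ := fun _ => 1) measurable_const fun _ _ _ => rfl
  simpa [volume_octant_diff] using this

theorem smul {c : ℝ} (hc : 0 < c) : IsUpperBody (c • C) where
  isClosed := hC.isClosed.smul_of_ne_zero hc.ne'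
  nonempty := hC.nonempty.smul_set
  subset_octant := by
    rintro _ ⟨x, hx, rfl⟩
    exact smul_mem_octant hc.le (hC.subset_octant hx)
  add_mem := by
    rintro _ ⟨x, hx, rfl⟩ y hy
    refine ⟨x + c⁻¹ • y, hC.add_mem x hx _ (smul_mem_octant (inv_pos.2 hc).le hy), ?_⟩
    simp only [smul_add, smul_inv_smul₀ hc.ne']

theorem subset_of_radial_ae_eq {C' : Set (Space d)} (hC' : IsUpperBody C')
    (h : ∀ᵐ θ : Metric.sphere (0 : Space d) 1 ∂(volume : Measure (Space d)).toSphere,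
      radial C (θ : Space d) = radial C' (θ : Space d)) : C' ⊆ C := by
  set T : Set (Space d) := {x | radial C x ≠ radial C' x} with hT
  have hTm : MeasurableSet T :=
    (measurableSet_eq_fun hC.measurable_radial hC'.measurable_radial).compl
  have hhom : ∀ (t : ℝ) x, 0 < t →
      T.indicator (1 : Space d → ℝ≥0∞) (t • x) = T.indicator 1 x := by
    intro t x ht
    have : t • x ∈ T ↔ x ∈ T := by
      simp only [hT, mem_ofPred_eq, radial_smul_vector _ ht, ne_eq,
        mul_right_inj' (inv_pos.2 ht).ne']
    simp only [indicator, this, Pi.one_apply]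
  have h1 := hC.lintegral_posOctant_diff (measurable_one.indicator hTm) hhom
  have h2 : ∫⁻ θ : Metric.sphere (0 : Space d) 1,
      ENNReal.ofReal (radial C (θ : Space d) ^ (d + 1)) *
      T.indicator (1 : Space d → ℝ≥0∞) (θ : Space d)
        ∂(volume : Measure (Space d)).toSphere = 0 := by
    refine (lintegral_congr_ae ?_).trans lintegral_zero
    filter_upwards [h] with θ hθ
    simp [hT, hθ]
  rw [h2, mul_eq_zero, or_iff_right (by simp), lintegral_indicator_one hTm,
    Measure.restrict_apply hTm] at h1
  have hO : IsOpen (interior C' \ C) := isOpen_interior.sdiff hC.isClosed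
  have h3 : interior C' \ C = ∅ := by
    refine (hO.measure_eq_zero_iff volume).1 (measure_mono_null (fun x hx => ?_) h1)
    have hpos := hC'.interior_subset_posOctant hx.1
    have h4 := hC'.radial_lt_of_mem_interior hx.1
    have h5 := hx.2
    rw [hC.mem_iff_radial_le hpos, not_le] at h5
    exact ⟨(h4.trans h5).ne', hpos, hx.2⟩
  rw [← hC'.closure_interior]
  exact closure_minimal (sdiff_eq_empty.1 h3) hC.isClosed

end IsUpperBody

/-! ### The mixed volume inequality -/

/-- Weighted arithmetic-geometric mean inequality with its equality case. -/
theorem mul_pow_lt_of_ne {d : ℕ} (hd : 1 ≤ d) {x y : ℝ} (hx : 0 ≤ x) (hy : 0 ≤ y) (hne : x ≠ y) :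
    (d + 1) * (x * y ^ d) < x ^ (d + 1) + d * y ^ (d + 1) := by
  rcases hy.eq_or_lt with rfl | hy
  · have : 0 < x := lt_of_le_of_ne hx hne.symm
    rw [zero_pow (by omega), zero_pow (by omega)]
    simp only [mul_zero, add_zero]
    positivity
  · have hz : x / y - 1 ≠ 0 := fun h => hne (by
      rw [sub_eq_zero, div_eq_one_iff_eq hy.ne'] at h; exact h)
    have hz1 : -1 ≤ x / y - 1 := by
      have : 0 ≤ x / y := by positivity
      linarith
    have h := one_add_mul_self_lt_rpow_one_add hz1 hz (p := (d + 1 : ℕ))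
      (by exact_mod_cast Nat.lt_succ_of_le hd)
    rw [Real.rpow_natCast, add_sub_cancel] at h
    have h2 := mul_lt_mul_of_pos_right h (pow_pos hy (d + 1))
    rw [div_pow, div_mul_cancel₀ _ (pow_pos hy (d + 1)).ne'] at h2
    have h3 : (1 + ((d + 1 : ℕ) : ℝ) * (x / y - 1)) * y ^ (d + 1) =
        (d + 1) * (x * y ^ d) - d * y ^ (d + 1) := by
      push_cast
      field_simp
      ring
    linarith

theorem mul_pow_le {d : ℕ} (hd : 1 ≤ d) {x y : ℝ} (hx : 0 ≤ x) (hy : 0 ≤ y) :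
    (d + 1) * (x * y ^ d) ≤ x ^ (d + 1) + d * y ^ (d + 1) := by
  rcases eq_or_ne x y with rfl | h
  · apply le_of_eq; ring
  · exact (mul_pow_lt_of_ne hd hx hy h).le

/-- For two upper bodies with unit volume below them, the mixed integral of the radial functions is
at most `d + 1`, and it reaches this value only if the bodies coincide. The deficit is the integral
of the deficit in the arithmetic-geometric mean inequality between the radial functions. -/
theorem IsUpperBody.mixed_volume (hd : 1 ≤ d) {C C₀ : Set (Space d)} (hC : IsUpperBody C)
    (hC₀ : IsUpperBody C₀) (hv : volume (octant d \ C) = 1) (hv₀ : volume (octant d \ C₀) = 1) :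
    ∫⁻ θ, ENNReal.ofReal (radial C₀ (θ : Space d) * radial C (θ : Space d) ^ d)
        ∂(volume : Measure (Space d)).toSphere ≤ d + 1 ∧
      (d + 1 ≤ ∫⁻ θ, ENNReal.ofReal (radial C₀ (θ : Space d) * radial C (θ : Space d) ^ d)
        ∂(volume : Measure (Space d)).toSphere → C = C₀) := by
  set σ := (volume : Measure (Space d)).toSphere
  have e := hC.volume_eq_lintegral_radial
  have e₀ := hC₀.volume_eq_lintegral_radial
  rw [hv, mul_one] at e
  rw [hv₀, mul_one] at e₀
  have hm := hC.measurable_radial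
  have hm₀ := hC₀.measurable_radial
  let D : Metric.sphere (0 : Space d) 1 → ℝ := fun θ =>
    radial C₀ (θ : Space d) ^ (d + 1) + d * radial C (θ : Space d) ^ (d + 1)
      - (d + 1) * (radial C₀ (θ : Space d) * radial C (θ : Space d) ^ d)
  have hD0 : ∀ θ, 0 ≤ D θ := fun θ =>
    sub_nonneg.2 (mul_pow_le hd (radial_nonneg _ _) (radial_nonneg _ _))
  have hDm : Measurable D := by fun_prop
  set I := ∫⁻ θ, ENNReal.ofReal (radial C₀ (θ : Space d) * radial C (θ : Space d) ^ d) ∂σ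
  have hsum : (d + 1 : ℝ≥0∞) * I + ∫⁻ θ, ENNReal.ofReal (D θ) ∂σ = (d + 1) * (d + 1) := by
    have h1 : ∀ θ : Metric.sphere (0 : Space d) 1,
        (d + 1 : ℝ≥0∞) * ENNReal.ofReal (radial C₀ (θ : Space d) * radial C (θ : Space d) ^ d) +
          ENNReal.ofReal (D θ) = ENNReal.ofReal (radial C₀ (θ : Space d) ^ (d + 1)) +
            d * ENNReal.ofReal (radial C (θ : Space d) ^ (d + 1)) := by
      intro θ
      have p := radial_nonneg C (θ : Space d)
      have p₀ := radial_nonneg C₀ (θ : Space d)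
      rw [← ofReal_natCast_add_one, ← ENNReal.ofReal_mul (by positivity),
        ← ENNReal.ofReal_add (by positivity) (hD0 θ), ← ENNReal.ofReal_natCast d,
        ← ENNReal.ofReal_mul (by positivity), ← ENNReal.ofReal_add (by positivity) (by positivity)]
      congr 1
      simp only [D]
      ring
    rw [← lintegral_const_mul _ (by fun_prop), ← lintegral_add_left (by fun_prop)]
    simp only [h1]
    rw [lintegral_add_left (by fun_prop), lintegral_const_mul _ (by fun_prop), ← e, ← e₀]
    ring
  have hne : (d + 1 : ℝ≥0∞) ≠ 0 := by simp
  have hnt : (d + 1 : ℝ≥0∞) ≠ ⊤ := by finiteness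
  constructor
  · rw [← ENNReal.mul_le_mul_iff_right hne hnt, ← hsum]
    exact le_self_add
  · intro hle
    have h0 : ∫⁻ θ, ENNReal.ofReal (D θ) ∂σ = 0 := by
      have h2 : (d + 1 : ℝ≥0∞) * (d + 1) + ∫⁻ θ, ENNReal.ofReal (D θ) ∂σ ≤
          (d + 1) * (d + 1) + 0 := by
        rw [add_zero]
        conv_rhs => rw [← hsum]
        gcongr
      exact le_antisymm (ENNReal.le_of_add_le_add_left (by finiteness) h2) zero_le
    rw [lintegral_eq_zero_iff (by fun_prop)] at h0
    have hae : ∀ᵐ θ : Metric.sphere (0 : Space d) 1 ∂σ,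
        radial C (θ : Space d) = radial C₀ (θ : Space d) := by
      filter_upwards [h0] with θ hθ
      by_contra hne
      have := mul_pow_lt_of_ne hd (radial_nonneg C₀ (θ : Space d)) (radial_nonneg C (θ : Space d))
        (Ne.symm hne)
      have h3 : D θ ≤ 0 := by simpa using hθ
      simp only [D] at h3
      linarith
    exact Subset.antisymm (hC₀.subset_of_radial_ae_eq hC (hae.mono fun _ h => h.symm))
      (hC.subset_of_radial_ae_eq hC₀ hae)

/-! ### The dual Wulff body -/

theorem isCompact_sphericalOctant : IsCompact (sphericalOctant d) :=
  (isCompact_sphere 0 1).inter_right isClosed_octant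

theorem single_mem_sphericalOctant (i : Fin (d + 1)) :
    (EuclideanSpace.single i 1 : Space d) ∈ sphericalOctant d := by
  refine ⟨by simp, fun j => ?_⟩
  simp only [PiLp.single_apply]
  split_ifs <;> norm_num

theorem single_mem_sphericalOctantBoundary (hd : 1 ≤ d) (i : Fin (d + 1)) :
    (EuclideanSpace.single i 1 : Space d) ∈ sphericalOctantBoundary d := by
  have : Nontrivial (Fin (d + 1)) := Fin.nontrivial_iff_two_le.2 (by omega)
  obtain ⟨j, hj⟩ := exists_ne i
  exact ⟨single_mem_sphericalOctant i, j, by simp [hj]⟩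

theorem VanishesAtBoundary.eq_zero {η : Space d → ℝ} (hbdry : VanishesAtBoundary η) {n : Space d}
    (hn : n ∈ sphericalOctantBoundary d) : η n = 0 := by
  by_contra hne
  obtain ⟨δ, hδ, h⟩ := hbdry _ (abs_pos.2 hne)
  exact lt_irrefl _ (h n hn.1 n hn (by simpa using hδ))

theorem one_le_inner_ones {n : Space d} (hn : n ∈ sphericalOctant d) : 1 ≤ inner ℝ (ones d) n := by
  have hnorm : ‖n‖ = 1 := by simpa using hn.1
  have h1 : ∑ i, n i ^ 2 = 1 := by
    have := EuclideanSpace.norm_sq_eq n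
    simpa [hnorm] using this.symm
  rw [PiLp.inner_apply, ← h1]
  refine Finset.sum_le_sum fun i _ => ?_
  have h2 := hn.2 i
  have h3 := abs_apply_le_norm n i
  rw [hnorm] at h3
  have h4 := le_abs_self (n i)
  simp only [ones_apply, RCLike.inner_apply, conj_trivial, mul_one]
  nlinarith

theorem isUpperBody_dualWulffBody {η : Space d → ℝ} (hcont : ContinuousOn η (sphericalOctant d))
    (hnonneg : ∀ n ∈ sphericalOctant d, 0 ≤ η n) : IsUpperBody (dualWulffBody η) where
  isClosed := by
    have : dualWulffBody η = ⋂ n ∈ sphericalOctant d, {x : Space d | η n ≤ inner ℝ x n} := by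
      ext; simp [dualWulffBody]
    rw [this]
    exact isClosed_biInter fun n _ => isClosed_le continuous_const (by fun_prop)
  nonempty := by
    obtain ⟨M, hM⟩ := isCompact_sphericalOctant.bddAbove_image hcont
    refine ⟨max M 0 • ones d, fun n hn => ?_⟩
    rw [inner_smul_left]
    calc η n ≤ max M 0 := (hM (mem_image_of_mem _ hn)).trans (le_max_left _ _)
      _ ≤ _ := le_mul_of_one_le_right (le_max_right _ _) (one_le_inner_ones hn)
  subset_octant := fun x hx i => by
    have h1 := hx _ (single_mem_sphericalOctant i)
    have h2 := hnonneg _ (single_mem_sphericalOctant i)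
    simpa [EuclideanSpace.inner_single_right] using h2.trans h1
  add_mem := fun x hx y hy n hn => by
    rw [inner_add_left]
    have := inner_nonneg_of_mem_octant hy hn.2
    linarith [hx n hn]

/-- At a boundary point of the dual Wulff body some constraint is active. -/
theorem exists_inner_eq_of_mem_frontier {η : Space d → ℝ}
    (hcont : ContinuousOn η (sphericalOctant d)) {x : Space d}
    (hx : x ∈ dualWulffBody η) (hxi : x ∉ interior (dualWulffBody η)) :
    ∃ m ∈ sphericalOctant d, inner ℝ x m = η m := by
  have hg : ContinuousOn (fun m => inner ℝ x m - η m) (sphericalOctant d) :=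
    (by fun_prop : Continuous fun m : Space d => (inner ℝ x m : ℝ)).continuousOn.sub hcont
  obtain ⟨m, hm, hmin⟩ := isCompact_sphericalOctant.exists_isMinOn
    ⟨_, single_mem_sphericalOctant 0⟩ hg
  refine ⟨m, hm, le_antisymm (not_lt.1 fun hlt => hxi ?_) (hx m hm)⟩
  refine mem_interior.2 ⟨Metric.ball x (inner ℝ x m - η m), fun y hy k hk => ?_,
    Metric.isOpen_ball, Metric.mem_ball_self (sub_pos.2 hlt)⟩
  have h1 : inner ℝ x m - η m ≤ inner ℝ x k - η k := hmin hk
  have h2 := abs_real_inner_le_norm (y - x) k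
  have h3 : ‖k‖ = 1 := by simpa using hk.1
  rw [h3, mul_one, inner_sub_left] at h2
  rw [Metric.mem_ball, dist_eq_norm] at hy
  linarith [(abs_le.1 h2).1]

/-- At a point of a dilated dual Wulff surface with a normal vector, the constraint in the
direction of the normal vector is active. -/
theorem inner_eq_of_isNormalAt_smul {η : Space d → ℝ}
    (hcont : ContinuousOn η (sphericalOctant d)) (hnonneg : ∀ n ∈ sphericalOctant d, 0 ≤ η n)
    {c : ℝ} (hc : 0 < c) {x n : Space d} (hx : x ∈ frontier (c • dualWulffBody η))
    (hn : IsNormalAt (frontier (c • dualWulffBody η)) x n) : inner ℝ x n = c * η n := by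
  have hK := isUpperBody_dualWulffBody hcont hnonneg
  have hcK := hK.smul hc
  rw [hcK.frontier_eq, interior_smul₀ hc.ne'] at hx
  obtain ⟨⟨y, hy, rfl⟩, hyi⟩ := hx
  simp only at hyi hn ⊢
  rw [smul_mem_smul_set_iff₀ hc.ne'] at hyi
  obtain ⟨m, hm, hmeq⟩ := exists_inner_eq_of_mem_frontier hcont hy hyi
  have : n = m := by
    refine hcK.isNormalAt_eq_of_forall_inner hn (by simpa using hm.1) ?_
    rintro _ ⟨z, hz, rfl⟩
    simp only [inner_smul_left, conj_trivial, hmeq]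
    exact mul_le_mul_of_nonneg_left (hz m hm) hc.le
  rw [this, inner_smul_left, conj_trivial, hmeq]

/-! ### The surface functional in polar coordinates -/

theorem lintegral_cone_radial (hd : 1 ≤ d) {C K : Set (Space d)} (hC : IsUpperBody C)
    (hK : IsUpperBody K) :
    ∫⁻ u in {u | (diagFrame d).graphMap (profile C) u ∈ posOctant d},
        ENNReal.ofReal (profile C u - fderiv ℝ (profile C) u u) *
          ENNReal.ofReal (radial K ((diagFrame d).graphMap (profile C) u)) =
      ∫⁻ θ, ENNReal.ofReal (radial K (θ : Space d) * radial C (θ : Space d) ^ d)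
        ∂(volume : Measure (Space d)).toSphere := by
  have hm := hC.measurable_radial
  have hmK := hK.measurable_radial
  have hφ : Measurable fun x => ENNReal.ofReal (radial K x / radial C x) := by fun_prop
  have hhom : ∀ (t : ℝ) (x : Space d), 0 < t →
      ENNReal.ofReal (radial K (t • x) / radial C (t • x)) =
        ENNReal.ofReal (radial K x / radial C x) := fun t x ht => by
    rw [radial_smul_vector _ ht, radial_smul_vector _ ht,
      mul_div_mul_left _ _ (inv_pos.2 ht).ne']
  have h1 := hC.lintegral_cone hφ hhom
  rw [hC.lintegral_posOctant_diff hφ hhom] at h1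
  have hU : MeasurableSet {u | (diagFrame d).graphMap (profile C) u ∈ posOctant d} :=
    (isOpen_posOctant.preimage
      ((diagFrame d).continuous_graphMap hC.lipschitz_profile.continuous)).measurableSet
  refine Eq.trans (setLIntegral_congr_fun hU fun u hu => ?_)
    (h1.trans (lintegral_congr fun θ => ?_))
  · rw [(hC.mem_frontier_iff hu).1 (hC.graphMap_mem_frontier u), div_one]
  · have p := radial_nonneg C (θ : Space d)
    rw [← ENNReal.ofReal_mul (by positivity)]
    congr 1
    rcases p.eq_or_lt with h0 | h0
    · rw [← h0, zero_pow (by omega), zero_pow (by omega)]; simp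
    · field_simp
      ring

section Functional

variable {η : Space d → ℝ} {C : Set (Space d)}

/-- At a point on the boundary of the octant, the normal vector of the surface of an upper body is
a coordinate vector, so that such points do not contribute to the functional. -/
theorem IsUpperBody.eta_normal_eq_zero (hd : 1 ≤ d) (hbdry : VanishesAtBoundary η)
    (hC : IsUpperBody C) {x n : Space d} (hxp : x ∉ posOctant d)
    (hn : IsNormalAt (frontier C) x n) : η n = 0 := by
  simp only [posOctant, mem_ofPred_eq, not_forall, not_lt] at hxp
  obtain ⟨i, hi⟩ := hxp
  have : n = EuclideanSpace.single i 1 := by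
    refine hC.isNormalAt_eq_of_forall_inner hn (by simp) fun y hy => ?_
    simpa [EuclideanSpace.inner_single_right] using hi.trans (hC.subset_octant hy i)
  rw [this]
  exact hbdry.eq_zero (single_mem_sphericalOctantBoundary hd i)

theorem IsUpperBody.functional_eq_setLIntegral (hd : 1 ≤ d) (hbdry : VanishesAtBoundary η)
    (hC : IsUpperBody C) : functional η (frontier C) =
      ∫⁻ u in {u | (diagFrame d).graphMap (profile C) u ∈ posOctant d},
        ENNReal.ofReal (Frame.areaFactor (fderiv ℝ (profile C) u)) *
          ENNReal.ofReal (η (graphNormal (fderiv ℝ (profile C) u))) := by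
  have hU : MeasurableSet {u | (diagFrame d).graphMap (profile C) u ∈ posOctant d} :=
    (isOpen_posOctant.preimage
      ((diagFrame d).continuous_graphMap hC.lipschitz_profile.continuous)).measurableSet
  rw [hC.functional_frontier, ← lintegral_indicator hU]
  refine lintegral_congr_ae ?_
  filter_upwards [hC.ae_differentiableAt_profile] with u hu
  by_cases hp : (diagFrame d).graphMap (profile C) u ∈ posOctant d
  · rw [indicator_of_mem (s := {u | (diagFrame d).graphMap (profile C) u ∈ posOctant d}) hp]
  · rw [indicator_of_notMem (s := {u | (diagFrame d).graphMap (profile C) u ∈ posOctant d}) hp,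
      hC.eta_normal_eq_zero hd hbdry hp
        (hC.isNormalAt_graphMap hu.hasFDerivAt)]
    simp

/-- The surface functional is at most the mixed volume with the dual Wulff body: the ray through a
point `x` of the surface meets the dual Wulff body, so that `η` at the normal vector `n` is at most
the inner product of `n` with the point where it does. -/
theorem IsUpperBody.functional_le (hd : 1 ≤ d) (hcont : ContinuousOn η (sphericalOctant d))
    (hnonneg : ∀ n ∈ sphericalOctant d, 0 ≤ η n) (hbdry : VanishesAtBoundary η)
    (hC : IsUpperBody C) : functional η (frontier C) ≤
      ∫⁻ θ, ENNReal.ofReal (radial (dualWulffBody η) (θ : Space d) * radial C (θ : Space d) ^ d)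
        ∂(volume : Measure (Space d)).toSphere := by
  have hK := isUpperBody_dualWulffBody hcont hnonneg
  have hU : MeasurableSet {u | (diagFrame d).graphMap (profile C) u ∈ posOctant d} :=
    (isOpen_posOctant.preimage
      ((diagFrame d).continuous_graphMap hC.lipschitz_profile.continuous)).measurableSet
  rw [hC.functional_eq_setLIntegral hd hbdry, ← lintegral_cone_radial hd hC hK]
  refine lintegral_mono_ae ?_
  filter_upwards [ae_restrict_mem hU, ae_restrict_of_ae hC.ae_differentiableAt_profile] with u hu hdu
  have hn := hC.isNormalAt_graphMap hdu.hasFDerivAt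
  have h1 := hK.radial_smul_mem hu _ (hC.isNormalAt_mem_sphericalOctant (hC.graphMap_mem u) hn)
  rw [inner_smul_left, conj_trivial] at h1
  have h2 := areaFactor_mul_inner_graphNormal (fderiv ℝ (profile C) u) (u, profile C u)
  have hA := (areaFactor_pos (fderiv ℝ (profile C) u)).le
  simp only at h2
  rw [← h2, ← ENNReal.ofReal_mul hA, mul_comm (ENNReal.ofReal (_ * _)),
    ← ENNReal.ofReal_mul (radial_nonneg _ _), mul_left_comm]
  exact ENNReal.ofReal_le_ofReal (mul_le_mul_of_nonneg_left h1 hA)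

/-- The dilated dual Wulff surfaces attain the mixed volume. -/
theorem functional_smul_dualWulffBody (hd : 1 ≤ d) (hcont : ContinuousOn η (sphericalOctant d))
    (hnonneg : ∀ n ∈ sphericalOctant d, 0 ≤ η n) (hbdry : VanishesAtBoundary η) {c : ℝ}
    (hc : 0 < c) : functional η (frontier (c • dualWulffBody η)) =
      ∫⁻ θ, ENNReal.ofReal (radial (dualWulffBody η) (θ : Space d) *
        radial (c • dualWulffBody η) (θ : Space d) ^ d)
        ∂(volume : Measure (Space d)).toSphere := by
  have hK := isUpperBody_dualWulffBody hcont hnonneg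
  have hC := hK.smul hc
  have hU : MeasurableSet {u | (diagFrame d).graphMap (profile (c • dualWulffBody η)) u ∈
      posOctant d} :=
    (isOpen_posOctant.preimage
      ((diagFrame d).continuous_graphMap hC.lipschitz_profile.continuous)).measurableSet
  rw [hC.functional_eq_setLIntegral hd hbdry, ← lintegral_cone_radial hd hC hK]
  refine lintegral_congr_ae ?_
  filter_upwards [ae_restrict_mem hU, ae_restrict_of_ae hC.ae_differentiableAt_profile] with u hu hdu
  have hn := hC.isNormalAt_graphMap hdu.hasFDerivAt
  have h1 := inner_eq_of_isNormalAt_smul hcont hnonneg hc (hC.graphMap_mem_frontier u) hn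
  have h2 := areaFactor_mul_inner_graphNormal (fderiv ℝ (profile (c • dualWulffBody η)) u)
    (u, profile (c • dualWulffBody η) u)
  have h3 := (hC.mem_frontier_iff hu).1 (hC.graphMap_mem_frontier u)
  rw [radial_smul_set hc] at h3
  have hA := (areaFactor_pos (fderiv ℝ (profile (c • dualWulffBody η)) u)).le
  simp only at h2
  rw [← Frame.graphMap, h1] at h2
  rw [← h2, ← ENNReal.ofReal_mul hA, mul_comm (ENNReal.ofReal (_ * _)),
    ← ENNReal.ofReal_mul (radial_nonneg _ _)]
  congr 1
  rw [mul_left_comm, ← mul_assoc (radial _ _), mul_comm (radial _ _) c, h3, one_mul]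

end Functional

variable {η : Space d → ℝ}

/-! ### Optimality of the dual Wulff surface -/

theorem frontier_smul_set {c : ℝ} (hc : c ≠ 0) (S : Set (Space d)) :
    frontier (c • S) = c • frontier S :=
  ((Homeomorph.smulOfNeZero c hc).image_frontier S).symm

theorem volume_octant_diff_smul {K : Set (Space d)} (hK : IsUpperBody K) {c : ℝ} (hc : 0 < c) :
    volume (octant d \ c • K) = ENNReal.ofReal (c ^ (d + 1)) * volume (octant d \ K) := by
  have hm := hK.measurable_radial
  have h1 := (hK.smul hc).volume_eq_lintegral_radial
  simp only [radial_smul_set hc, mul_pow, ENNReal.ofReal_mul (pow_nonneg hc.le (d + 1))] at h1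
  rw [lintegral_const_mul _ (by fun_prop), ← hK.volume_eq_lintegral_radial, mul_left_comm] at h1
  exact (ENNReal.mul_right_inj (by simp) (by finiteness)).1 h1

theorem exists_pow_mul_eq_one {W : ℝ≥0∞} (h0 : W ≠ 0) (ht : W ≠ ⊤) (d : ℕ) :
    0 < (1 / W.toReal) ^ (1 / ((d : ℝ) + 1)) ∧
      ((1 / W.toReal) ^ (1 / ((d : ℝ) + 1))) ^ (d + 1) * W.toReal = 1 ∧
      ENNReal.ofReal (((1 / W.toReal) ^ (1 / ((d : ℝ) + 1))) ^ (d + 1)) * W = 1 := by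
  have hW : 0 < W.toReal := ENNReal.toReal_pos h0 ht
  have h1 : ((1 / W.toReal) ^ (1 / ((d : ℝ) + 1))) ^ (d + 1) = 1 / W.toReal := by
    rw [← Real.rpow_natCast, ← Real.rpow_mul (by positivity)]
    push_cast
    rw [one_div_mul_cancel (by positivity), Real.rpow_one]
  refine ⟨by positivity, by rw [h1, one_div_mul_cancel hW.ne'], ?_⟩
  conv_lhs => rw [h1, ← ENNReal.ofReal_toReal ht]
  rw [ENNReal.toReal_ofReal hW.le, ← ENNReal.ofReal_mul (by positivity),
    one_div_mul_cancel hW.ne', ENNReal.ofReal_one]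

section

variable (hd : 1 ≤ d) (hcont : ContinuousOn η (sphericalOctant d))
  (hnonneg : ∀ n ∈ sphericalOctant d, 0 ≤ η n) (hbdry : VanishesAtBoundary η)
include hd hcont hnonneg hbdry

theorem functional_dualWulffSurface : functional η (dualWulffSurface η) =
    (d + 1) * volume (octant d \ dualWulffBody η) := by
  have h := functional_smul_dualWulffBody hd hcont hnonneg hbdry one_pos
  rw [one_smul] at h
  rw [dualWulffSurface, h, (isUpperBody_dualWulffBody hcont hnonneg).volume_eq_lintegral_radial]
  simp only [pow_succ']

theorem functional_normalized {c : ℝ} (hc : 0 < c)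
    (hv : volume (octant d \ c • dualWulffBody η) = 1) :
    functional η (frontier (c • dualWulffBody η)) = ENNReal.ofReal c⁻¹ * (d + 1) := by
  have hK := isUpperBody_dualWulffBody hcont hnonneg
  have hm := (hK.smul hc).measurable_radial
  have h1 := (hK.smul hc).volume_eq_lintegral_radial
  rw [hv, mul_one] at h1
  rw [functional_smul_dualWulffBody hd hcont hnonneg hbdry hc, h1,
    ← lintegral_const_mul _ (by fun_prop)]
  refine lintegral_congr fun θ => ?_
  rw [← ENNReal.ofReal_mul (inv_pos.2 hc).le, pow_succ', ← mul_assoc]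
  congr 2
  rw [radial_smul_set hc, inv_mul_cancel_left₀ hc.ne']

theorem functional_le_of_isMonotoneSurface {c : ℝ} (hc : 0 < c)
    (hv : volume (octant d \ c • dualWulffBody η) = 1) {G : Set (Space d)}
    (hG : IsMonotoneSurface 1 G) :
    functional η G ≤ ENNReal.ofReal c⁻¹ * (d + 1) ∧
      (ENNReal.ofReal c⁻¹ * (d + 1) ≤ functional η G → G = frontier (c • dualWulffBody η)) := by
  have hK := isUpperBody_dualWulffBody hcont hnonneg
  have hcK := hK.smul hc
  obtain ⟨C, hC, rfl, hvC⟩ := hG.exists_isUpperBody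
  have hm := hC.measurable_radial
  have hmK := hcK.measurable_radial
  obtain ⟨h1, h2⟩ := hC.mixed_volume hd hcK hvC hv
  have h3 := hC.functional_le hd hcont hnonneg hbdry
  have h4 : ∫⁻ θ, ENNReal.ofReal (radial (dualWulffBody η) (θ : Space d) *
        radial C (θ : Space d) ^ d) ∂(volume : Measure (Space d)).toSphere =
      ENNReal.ofReal c⁻¹ * ∫⁻ θ, ENNReal.ofReal (radial (c • dualWulffBody η) (θ : Space d) *
        radial C (θ : Space d) ^ d) ∂(volume : Measure (Space d)).toSphere := by
    rw [← lintegral_const_mul _ (by fun_prop)]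
    refine lintegral_congr fun θ => ?_
    rw [← ENNReal.ofReal_mul (inv_pos.2 hc).le, ← mul_assoc, radial_smul_set hc,
      inv_mul_cancel_left₀ hc.ne']
  rw [h4] at h3
  refine ⟨h3.trans (by gcongr), fun hle => ?_⟩
  have h5 := hle.trans h3
  rw [ENNReal.mul_le_mul_iff_right (by simpa using hc) (by finiteness)] at h5
  rw [h2 h5]

end

theorem volume_octant_diff_dualWulffBody_ne_zero (hcont : ContinuousOn η (sphericalOctant d))
    (hnonneg : ∀ n ∈ sphericalOctant d, 0 ≤ η n) (hne : ∃ n ∈ sphericalOctant d, η n ≠ 0) :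
    volume (octant d \ dualWulffBody η) ≠ 0 := by
  have hK := isUpperBody_dualWulffBody hcont hnonneg
  obtain ⟨n, hn, hn0⟩ := hne
  have hpos : 0 < η n := lt_of_le_of_ne (hnonneg n hn) hn0.symm
  have h1 := one_le_inner_ones hn
  rw [volume_octant_diff]
  refine (isOpen_posOctant.sdiff hK.isClosed).measure_ne_zero volume
    ⟨(η n / (2 * inner ℝ (ones d) n)) • ones d,
      smul_mem_posOctant (by positivity) ones_mem_posOctant, fun h => ?_⟩
  have h2 := h n hn
  rw [inner_smul_left, conj_trivial, div_mul_eq_mul_div, le_div_iff₀ (by positivity)] at h2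
  nlinarith

/-! ### Truncation -/

/-- The truncation `max (η - ε, 0)`, which vanishes in a neighbourhood of the boundary of the
spherical octant. -/
def truncation (η : Space d → ℝ) (ε : ℝ) (n : Space d) : ℝ := max (η n - ε) 0

theorem continuousOn_truncation (hcont : ContinuousOn η (sphericalOctant d)) (ε : ℝ) :
    ContinuousOn (truncation η ε) (sphericalOctant d) :=
  (hcont.sub continuousOn_const).sup continuousOn_const

theorem truncation_nonneg (ε : ℝ) (n : Space d) : 0 ≤ truncation η ε n := le_max_right _ _

theorem VanishesAtBoundary.truncation (hbdry : VanishesAtBoundary η) {ε : ℝ} (hε : 0 ≤ ε) :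
    VanishesAtBoundary (truncation η ε) := by
  intro ε' hε'
  obtain ⟨δ, hδ, h⟩ := hbdry ε' hε'
  refine ⟨δ, hδ, fun n hn m hm hnm => ?_⟩
  have h1 := h n hn m hm hnm
  rw [abs_of_nonneg (truncation_nonneg ε n), DualWulff.truncation, max_lt_iff]
  exact ⟨by linarith [le_abs_self (η n)], hε'⟩

theorem functional_truncation_le {ε : ℝ} (hε : 0 ≤ ε) (G : Set (Space d)) :
    functional (truncation η ε) G ≤ functional η G := by
  refine lintegral_mono fun x => ?_
  rw [truncation]
  rcases le_total (η (normal G x) - ε) 0 with h | h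
  · simp [max_eq_right h]
  · rw [max_eq_left h]
    exact ENNReal.ofReal_le_ofReal (by linarith)

/-- The body of a truncation lies above a bounded region: the directions where the truncation does
not vanish form a compact set on which all coordinates are bounded away from zero. -/
theorem volume_octant_diff_truncation_ne_top (hcont : ContinuousOn η (sphericalOctant d))
    (hbdry : VanishesAtBoundary η) {ε : ℝ} (hε : 0 < ε) :
    volume (octant d \ dualWulffBody (truncation η ε)) ≠ ⊤ := by
  have hS : IsCompact {n ∈ sphericalOctant d | ε ≤ η n} :=
    isCompact_sphericalOctant.of_isClosed_subset
      (hcont.preimage_isClosed_of_isClosed isCompact_sphericalOctant.isClosed isClosed_Ici)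
      fun n hn => hn.1
  have hδ : ∀ i : Fin (d + 1), ∃ δ > 0, ∀ n ∈ sphericalOctant d, ε ≤ η n → δ ≤ n i := by
    intro i
    rcases eq_empty_or_nonempty {n ∈ sphericalOctant d | ε ≤ η n} with he | hne
    · refine ⟨1, one_pos, fun n hn h => ?_⟩
      have : n ∈ (∅ : Set (Space d)) := he ▸ ⟨hn, h⟩
      exact this.elim
    · obtain ⟨m, hm, hmin⟩ := hS.exists_isMinOn hne (continuous_apply' i).continuousOn
      refine ⟨m i, lt_of_le_of_ne (hm.1.2 i) fun h0 => ?_, fun n hn h => hmin ⟨hn, h⟩⟩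
      have := hbdry.eq_zero ⟨hm.1, i, h0.symm⟩
      linarith [hm.2]
  choose δ hδ0 hδ using hδ
  obtain ⟨M, hM⟩ := isCompact_sphericalOctant.bddAbove_image hcont
  have hsub : octant d \ dualWulffBody (truncation η ε) ⊆
      WithLp.ofLp ⁻¹' Icc (0 : Fin (d + 1) → ℝ) fun i => M / δ i := by
    rintro x ⟨hx, hxK⟩
    simp only [dualWulffBody, mem_ofPred_eq, not_forall, not_le] at hxK
    obtain ⟨n, hn, hlt⟩ := hxK
    have h0 : 0 < truncation η ε n := (inner_nonneg_of_mem_octant hx hn.2).trans_lt hlt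
    have h1 : 0 < η n - ε := by
      rcases lt_max_iff.1 h0 with h | h
      · exact h
      · exact (lt_irrefl _ h).elim
    have h2 : truncation η ε n = η n - ε := max_eq_left h1.le
    refine ⟨fun i => hx i, fun i => ?_⟩
    rw [le_div_iff₀ (hδ0 i)]
    have h3 : x i * n i ≤ inner ℝ x n := by
      rw [PiLp.inner_apply]
      have := Finset.single_le_sum (f := fun j => inner ℝ (x j) (n j))
        (fun j _ => by simpa using mul_nonneg (hn.2 j) (hx j)) (Finset.mem_univ i)
      simpa [mul_comm] using this
    have h4 := mul_le_mul_of_nonneg_left (hδ i n hn (by linarith)) (hx i)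
    have h5 := hM (mem_image_of_mem η hn)
    linarith
  refine ne_top_of_le_ne_top ?_ (measure_mono hsub)
  rw [(PiLp.volume_preserving_ofLp (Fin (d + 1))).measure_preimage
    measurableSet_Icc.nullMeasurableSet]
  exact isCompact_Icc.measure_lt_top.ne

theorem iUnion_octant_diff_truncation (hnonneg : ∀ n ∈ sphericalOctant d, 0 ≤ η n) :
    ⋃ m : ℕ, octant d \ dualWulffBody (truncation η (1 / ((m : ℝ) + 1))) =
      octant d \ dualWulffBody η := by
  ext x
  simp only [mem_iUnion, mem_sdiff, dualWulffBody, mem_ofPred_eq, not_forall, not_le]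
  constructor
  · rintro ⟨m, hx, n, hn, hlt⟩
    refine ⟨hx, n, hn, hlt.trans_le (max_le ?_ (hnonneg n hn))⟩
    have : (0 : ℝ) ≤ 1 / ((m : ℝ) + 1) := by positivity
    linarith
  · rintro ⟨hx, n, hn, hlt⟩
    obtain ⟨m, hm⟩ := exists_nat_one_div_lt (sub_pos.2 hlt)
    exact ⟨m, hx, n, hn, lt_max_of_lt_left (by linarith)⟩

theorem monotone_octant_diff_truncation :
    Monotone fun m : ℕ => octant d \ dualWulffBody (truncation η (1 / ((m : ℝ) + 1))) := by
  intro m m' hmm x hx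
  refine ⟨hx.1, fun h => hx.2 fun n hn => (max_le_max ?_ le_rfl).trans (h n hn)⟩
  have : 1 / ((m' : ℝ) + 1) ≤ 1 / ((m : ℝ) + 1) := by gcongr
  linarith

theorem iSup_functional_eq_top (hd : 1 ≤ d) (hcont : ContinuousOn η (sphericalOctant d))
    (hnonneg : ∀ n ∈ sphericalOctant d, 0 ≤ η n) (hbdry : VanishesAtBoundary η)
    (htop : volume (octant d \ dualWulffBody η) = ⊤) :
    (⨆ G ∈ monotoneSurfaces d 1, functional η G) = ⊤ := by
  refine ENNReal.eq_top_of_forall_nnreal_le fun r => ?_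
  rw [← iUnion_octant_diff_truncation hnonneg,
    monotone_octant_diff_truncation.measure_iUnion] at htop
  obtain ⟨m, hm⟩ := lt_iSup_iff.1 (htop ▸ (by finiteness : (r : ℝ≥0∞) ^ (d + 1) < ⊤))
  set ε : ℝ := 1 / ((m : ℝ) + 1)
  have hε : 0 < ε := by positivity
  have hcont' := continuousOn_truncation hcont ε
  have hnonneg' : ∀ n ∈ sphericalOctant d, 0 ≤ truncation η ε n := fun n _ => truncation_nonneg ε n
  have hK := isUpperBody_dualWulffBody hcont' hnonneg'
  set W := volume (octant d \ dualWulffBody (truncation η ε))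
  have hW0 : W ≠ 0 := (zero_le.trans_lt hm).ne'
  have hWt : W ≠ ⊤ := volume_octant_diff_truncation_ne_top hcont hbdry hε
  obtain ⟨hc, hc1, hc2⟩ := exists_pow_mul_eq_one hW0 hWt d
  set c := (1 / W.toReal) ^ (1 / ((d : ℝ) + 1))
  have hv : volume (octant d \ c • dualWulffBody (truncation η ε)) = 1 := by
    rw [volume_octant_diff_smul hK hc, hc2]
  have hmem : frontier (c • dualWulffBody (truncation η ε)) ∈ monotoneSurfaces d 1 := by
    have := (hK.smul hc).isMonotoneSurface_frontier
    rwa [hv] at this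
  have hrc : (r : ℝ) ≤ c⁻¹ := by
    refine le_of_pow_le_pow_left₀ (Nat.succ_ne_zero d) (inv_pos.2 hc).le ?_
    rw [inv_pow, ← eq_inv_of_mul_eq_one_right hc1]
    have := ENNReal.toReal_mono hWt hm.le
    simpa using this
  calc (r : ℝ≥0∞) ≤ ENNReal.ofReal c⁻¹ := by
        rw [← ENNReal.ofReal_coe_nnreal]; exact ENNReal.ofReal_le_ofReal hrc
    _ ≤ ENNReal.ofReal c⁻¹ * (d + 1) := le_mul_of_one_le_right zero_le le_add_self
    _ = functional (truncation η ε) (frontier (c • dualWulffBody (truncation η ε))) :=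
        (functional_normalized hd hcont' hnonneg' (hbdry.truncation hε.le) hc hv).symm
    _ ≤ functional η (frontier (c • dualWulffBody (truncation η ε))) :=
        functional_truncation_le hε.le _
    _ ≤ _ := le_iSup₂_of_le _ hmem le_rfl

end

end DualWulff

theorem mainTheorem1 (d : ℕ) (hd : 1 ≤ d) (η : DualWulff.Space d → ℝ)
    (hcont : ContinuousOn η (DualWulff.sphericalOctant d))
    (hnonneg : ∀ n ∈ DualWulff.sphericalOctant d, 0 ≤ η n)
    (hbdry : DualWulff.VanishesAtBoundary η)
    (hne : ∃ n ∈ DualWulff.sphericalOctant d, η n ≠ 0) :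
    (DualWulff.vol (DualWulff.dualWulffSurface η) < ⊤ →
      ∀ G : Set (DualWulff.Space d),
        (G ∈ DualWulff.monotoneSurfaces d 1 ∧
          IsMaxOn (DualWulff.functional η) (DualWulff.monotoneSurfaces d 1) G) ↔
        G = (((d : ℝ) + 1) /
              (DualWulff.functional η (DualWulff.dualWulffSurface η)).toReal) ^
                (1 / ((d : ℝ) + 1)) • DualWulff.dualWulffSurface η) ∧
    (DualWulff.vol (DualWulff.dualWulffSurface η) = ⊤ →
      (⨆ G ∈ DualWulff.monotoneSurfaces d 1, DualWulff.functional η G) = ⊤) := by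
  have hK := DualWulff.isUpperBody_dualWulffBody hcont hnonneg
  have hvol : DualWulff.vol (DualWulff.dualWulffSurface η) =
      volume (DualWulff.octant d \ DualWulff.dualWulffBody η) := by
    rw [DualWulff.vol, DualWulff.dualWulffSurface, hK.body_frontier]
  rw [hvol]
  refine ⟨fun hlt => ?_, DualWulff.iSup_functional_eq_top hd hcont hnonneg hbdry⟩
  have hW0 := DualWulff.volume_octant_diff_dualWulffBody_ne_zero hcont hnonneg hne
  have hscale : ((d : ℝ) + 1) / (DualWulff.functional η (DualWulff.dualWulffSurface η)).toReal =
      1 / (volume (DualWulff.octant d \ DualWulff.dualWulffBody η)).toReal := by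
    rw [DualWulff.functional_dualWulffSurface hd hcont hnonneg hbdry, ENNReal.toReal_mul,
      ← DualWulff.ofReal_natCast_add_one, ENNReal.toReal_ofReal (by positivity),
      div_mul_eq_div_div, div_self (by positivity)]
  rw [hscale]
  obtain ⟨hc, -, hc2⟩ := DualWulff.exists_pow_mul_eq_one hW0 hlt.ne d
  set c := (1 / (volume (DualWulff.octant d \ DualWulff.dualWulffBody η)).toReal) ^
    (1 / ((d : ℝ) + 1))
  have hv : volume (DualWulff.octant d \ c • DualWulff.dualWulffBody η) = 1 := by
    rw [DualWulff.volume_octant_diff_smul hK hc, hc2]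
  rw [DualWulff.dualWulffSurface, ← DualWulff.frontier_smul_set hc.ne']
  have hmem : frontier (c • DualWulff.dualWulffBody η) ∈ DualWulff.monotoneSurfaces d 1 := by
    have := (hK.smul hc).isMonotoneSurface_frontier
    rwa [hv] at this
  have hval := DualWulff.functional_normalized hd hcont hnonneg hbdry hc hv
  intro G
  constructor
  · rintro ⟨hG, hmax⟩
    refine (DualWulff.functional_le_of_isMonotoneSurface hd hcont hnonneg hbdry hc hv hG).2 ?_
    rw [← hval]
    exact hmax hmem
  · rintro rfl
    refine ⟨hmem, fun G hG => ?_⟩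
    rw [mem_ofPred_eq, hval]
    exact (DualWulff.functional_le_of_isMonotoneSurface hd hcont hnonneg hbdry hc hv hG).1
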